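/- Let $C$ be a compact Hausdorff space, $\sigma:C\to C$ a surjective local homeomorphism, $\alpha(f)=f\circ\sigma$ on $A:=C(C)$, and $L(f)(c)=|\sigma^{-1}(c)|^{-1}\sum_{\sigma(d)=c}f(d)$ the normalized transfer operator. For a Hilbert $A$-module $X$ and $k\ge 0$, let $X_{L^k}$ be the Hilbert $A$-module with underlying space $X$, module action $x\cdot\alpha^k(f)$ and inner product $L^k(\langle x,y\rangle)$; write $X_L=X_{L^1}$. Let $M_L=(A_A)_L$ be Exel's correspondence, with left action by multiplication. All tensor products are internal, $X\otimes_A M_L$ is identified with $X_L$ via $x\otimes f\mapsto x\cdot f$, and the direct limit of a sequence of Hilbert modules and inner-product preserving module maps is the completion of its algebraic direct limit. Given closed submodules $V_k$ $(k\ge 0)$ of a closed submodule $W$ of a Hilbert module $X$ and a linear bijection $D:X\to X$, we say that $\{V_k\}$ is a projective multi-resolution analysis for $W$ if (i) $V_0$ is a complemented submodule of $W$; (ii) $V_k=D^{-k}(V_0)$ for $k\ge 0$; (iii) $V_k$ is a complemented submodule of $V_{k+1}$ for $k\ge 0$; (iv) $\bigcup_k V_k$ is dense in $W$. (1) Let $Y$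 be a Hilbert $A$-module and let $T:Y\to Y_L$ be adjointable and inner-product preserving. Then for every $k\ge 0$, $T$ is also adjointable and inner-product preserving as a map $Y_{L^k}\to Y_{L^{k+1}}$. Let $(Y_\infty,\iota^k)=\varinjlim(Y_{L^k},T)$. There is a Hilbert-module isomorphism $R$ of $Y_\infty$ onto $Y_\infty\otimes_A M_L=(Y_\infty)_L$ such that $R\circ\iota^{k+1}=\iota^k\otimes\mathrm{id}$ for $k\ge 0$ (where $Y_{L^{k+1}}=(Y_{L^k})_L=Y_{L^k}\otimes_A M_L$), with the following property. Suppose that $X$ is a Hilbert $A$-module, that $D:X\to X$ is a linear bijection with $$D(x\cdot f)=(Dx)\cdot\alpha(f)\quad\text{and}\quad L(\langle Dx,Dy\rangle)=\langle x,y\rangle ,$$ and that $Q_0:Y\to X$ is inner-product preserving with $D\circ Q_0=Q_0\circ T$. Then there is an inner-product preserving map $Q:Y_\infty\to X$ such that $Q\circ\iota^0=Q_0$ and $D\circ Q=Q\circ R$, and the submodules $V_k:=Q(\iota^k(Y_{L^k}))$ form a projective multi-resolution analysis for $Q(Y_\infty)$. (2) Let $m\in M_L$ be a filter, that is, $\langle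 m,m\rangle=1$ in $M_L$. Let $M_\infty=\varinjlim(M_L^{\otimes k},T_k)$, where $M_L^{\otimes 0}=A$, $T_0a=m\cdot a$, and $T_kn=m\otimes n$ for $k\ge 1$. There is a Hilbert-module isomorphism $R$ of $M_\infty$ onto $M_\infty\otimes_A M_L=(M_\infty)_L$ such that $R\circ\iota^{k+1}=\iota^k\otimes\mathrm{id}$ for $k\ge 0$ (where $A\otimes_A M_L=M_L$), with the following property. Suppose that $X$ is a Hilbert $A$-module, $\phi\in X$ satisfies $\langle\phi,\phi\rangle=1$, and $D:X\to X$ is a linear bijection with $$D(x\cdot f)=(Dx)\cdot\alpha(f),\quad L(\langle Dx,Dy\rangle)=\langle x,y\rangle\quad\text{and}\quad D\phi=\phi\cdot m .$$ Then $(X,D,\phi)$ is a scaling function for $m$: regarded as a map $X\to X_L=X\otimes_A M_L$, $D$ is a Hilbert-module isomorphism with $D\phi=\phi\otimes m$. Moreover there is an inner-product preserving module map $Q:M_\infty\to X$ such that $(Q\circ\iota^0)(1)=\phi$ and $D\circ Q=Q\circ R$, and the submodules $V_k:=Q(\iota^k(M_L^{\otimes k}))=D^{-k}(V_0)$ form a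 projective multi-resolution analysis for $Q(M_\infty)$. -/

import Mathlib

open scoped ComplexOrder TensorProduct

universe u v w

set_option linter.unusedSectionVars false

noncomputable section

/-- A surjective local homeomorphism `σ` of the space `C`. -/
structure ExelSystem (C : Type w) [TopologicalSpace C] where
  /-- the map `σ` -/
  map : C → C
  isLocalHomeomorph : IsLocalHomeomorph map
  surjective : Function.Surjective map

namespace ExelSystem

variable {C : Type w} [TopologicalSpace C] [CompactSpace C] [T2Space C] (S : ExelSystem C)

theorem continuous_map : Continuous S.map := S.isLocalHomeomorph.continuous

/-- The endomorphism `α : f ↦ f ∘ σ` of `C(C)`. -/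
def endo : C(C, ℂ) →⋆ₐ[ℂ] C(C, ℂ) :=
  ContinuousMap.compStarAlgHom' ℂ ℂ ⟨S.map, S.continuous_map⟩

theorem endo_apply (f : C(C, ℂ)) (c : C) : S.endo f c = f (S.map c) := rfl

theorem finite_fiber (c : C) : (S.map ⁻¹' {c}).Finite := by
  refine (isClosed_singleton.preimage S.continuous_map).isCompact.finite ?_
  have h := (isLocalHomeomorph_iff_isCoveringMap.mp S.isLocalHomeomorph c).discreteTopology_fiber
  exact isDiscrete_iff_discreteTopology.mpr h

/-- The finite set `σ⁻¹(c)`. -/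
def fiber (c : C) : Finset C := (S.finite_fiber c).toFinset

theorem mem_fiber {c d : C} : d ∈ S.fiber c ↔ S.map d = c := by simp [fiber]

theorem card_fiber_pos (c : C) : 0 < (S.fiber c).card := by
  obtain ⟨d, hd⟩ := S.surjective c
  exact Finset.card_pos.mpr ⟨d, S.mem_fiber.mpr hd⟩

/-- Locally, sums over the fibres are sums over finitely many continuous sections of `σ`. -/
theorem exists_local_sections (c : C) : ∃ (U : Set C) (n : ℕ) (s : Fin n → U → C),
    IsOpen U ∧ c ∈ U ∧ (∀ i, Continuous (s i)) ∧
    (∀ x : U, Function.Injective fun i => s i x) ∧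
    ∀ (x : U) (d : C), S.map d = x ↔ ∃ i, s i x = d := by
  obtain ⟨hI, U, hcU, hU, -, H, hH⟩ :=
    isLocalHomeomorph_iff_isCoveringMap.mp S.isLocalHomeomorph c
  have : Finite (S.map ⁻¹' {c}) := S.finite_fiber c
  obtain ⟨n, ⟨e⟩⟩ := Finite.exists_equiv_fin (S.map ⁻¹' {c})
  refine ⟨U, n, fun i x => (H.symm (x, e.symm i)).1, hU, hcU, fun i => ?_, fun x i j hij => ?_,
    fun x d => ⟨fun hd => ?_, ?_⟩⟩
  · fun_prop
  · have := H.symm.injective (Subtype.ext hij)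
    simpa using this
  · have hdU : d ∈ S.map ⁻¹' U := by simp [hd]
    refine ⟨e (H ⟨d, hdU⟩).2, ?_⟩
    have : (x, (H ⟨d, hdU⟩).2) = H ⟨d, hdU⟩ := by
      refine Prod.ext (Subtype.ext ?_) rfl
      simp [hH, hd]
    simp [this]
  · rintro ⟨i, rfl⟩
    have := hH (H.symm (x, e.symm i))
    simpa using this.symm

theorem sum_fiber_eq {c : C} {n : ℕ} (s : Fin n → C) (hs : Function.Injective s)
    (h : ∀ d, S.map d = c ↔ ∃ i, s i = d) (f : C → ℂ) :
    ∑ d ∈ S.fiber c, f d = ∑ i, f (s i) := by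
  classical
  have : S.fiber c = Finset.univ.image s := by
    ext d; simp [mem_fiber, h]
  rw [this, Finset.sum_image (fun i _ j _ hij => hs hij)]

theorem card_fiber_eq {c : C} {n : ℕ} (s : Fin n → C) (hs : Function.Injective s)
    (h : ∀ d, S.map d = c ↔ ∃ i, s i = d) : (S.fiber c).card = n := by
  classical
  have : S.fiber c = Finset.univ.image s := by
    ext d; simp [mem_fiber, h]
  rw [this, Finset.card_image_of_injective _ hs, Finset.card_univ, Fintype.card_fin]

theorem continuous_transfer (f : C(C, ℂ)) :
    Continuous fun c => ((S.fiber c).card : ℂ)⁻¹ * ∑ d ∈ S.fiber c, f d := by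
  rw [continuous_iff_continuousAt]
  intro c
  obtain ⟨U, n, s, hU, hc, hs, hinj, hmem⟩ := S.exists_local_sections c
  have key : ContinuousOn (fun c => ((S.fiber c).card : ℂ)⁻¹ * ∑ d ∈ S.fiber c, f d) U := by
    rw [continuousOn_iff_continuous_domRestrict]
    have : U.domRestrict (fun c => ((S.fiber c).card : ℂ)⁻¹ * ∑ d ∈ S.fiber c, f d) =
        fun x : U => (n : ℂ)⁻¹ * ∑ i, f (s i x) := by
      funext x
      have h1 := S.sum_fiber_eq (fun i => s i x) (hinj x) (hmem x) f
      have h2 := S.card_fiber_eq (fun i => s i x) (hinj x) (hmem x)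
      simp [h1, h2]
    rw [this]
    have := fun i => f.continuous.comp (hs i)
    simp only [Function.comp_def] at this
    fun_prop
  exact key.continuousAt (hU.mem_nhds hc)

/-- The normalized transfer operator
`L(f)(c) = |σ⁻¹(c)|⁻¹ ∑_{σ(d) = c} f(d)`. -/
def transfer : C(C, ℂ) →ₗ[ℂ] C(C, ℂ) where
  toFun f := ⟨fun c => ((S.fiber c).card : ℂ)⁻¹ * ∑ d ∈ S.fiber c, f d, S.continuous_transfer f⟩
  map_add' f g := by ext c; simp [Finset.sum_add_distrib, mul_add]
  map_smul' z f := by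
    ext c
    simp only [ContinuousMap.coe_mk, ContinuousMap.smul_apply, smul_eq_mul, RingHom.id_apply,
      ← Finset.mul_sum]
    ring

theorem transfer_apply (f : C(C, ℂ)) (c : C) :
    S.transfer f c = ((S.fiber c).card : ℂ)⁻¹ * ∑ d ∈ S.fiber c, f d := rfl

theorem transfer_endo_mul (a f : C(C, ℂ)) :
    S.transfer (S.endo a * f) = a * S.transfer f := by
  ext c
  simp only [transfer_apply, ContinuousMap.mul_apply]
  rw [Finset.sum_congr rfl (g := fun d => a c * f d), ← Finset.mul_sum]
  · ring
  · intro d hd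
    rw [endo_apply, S.mem_fiber.mp hd]

theorem transfer_star (f : C(C, ℂ)) : S.transfer (star f) = star (S.transfer f) := by
  ext c
  simp [transfer_apply]

theorem transfer_nonneg {f : C(C, ℂ)} (hf : 0 ≤ f) : 0 ≤ S.transfer f := by
  intro c
  change 0 ≤ S.transfer f c
  rw [transfer_apply]
  exact mul_nonneg (by simp) (Finset.sum_nonneg fun d _ => hf d)

theorem exists_card_fiber_le : ∃ K : ℕ, ∀ c, (S.fiber c).card ≤ K := by
  choose U n s hU hc _ hinj hmem using S.exists_local_sections
  obtain ⟨t, ht⟩ := isCompact_univ.elim_nhds_subcover U fun x _ => (hU x).mem_nhds (hc x)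
  refine ⟨t.sup n, fun c => ?_⟩
  obtain ⟨x, hx, hcx⟩ := Set.mem_iUnion₂.mp (ht.2 (Set.mem_univ c))
  rw [S.card_fiber_eq (fun i => s x i ⟨c, hcx⟩) (hinj x _) (hmem x ⟨c, hcx⟩)]
  exact Finset.le_sup hx

/-- On positive functions, `L` is bounded below. -/
theorem exists_norm_le_transfer : ∃ K : ℝ, 0 ≤ K ∧ ∀ f : C(C, ℂ), 0 ≤ f →
    ‖f‖ ≤ K * ‖S.transfer f‖ := by
  obtain ⟨K, hK⟩ := S.exists_card_fiber_le
  refine ⟨K, by positivity, fun f hf => ?_⟩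
  rw [ContinuousMap.norm_le _ (by positivity)]
  intro d
  have h1 : f d ≤ ∑ d' ∈ S.fiber (S.map d), f d' :=
    Finset.single_le_sum (f := fun d' => f d') (fun d' _ => hf d') (S.mem_fiber.mpr rfl)
  have h2 : ∑ d' ∈ S.fiber (S.map d), f d' =
      ((S.fiber (S.map d)).card : ℂ) * S.transfer f (S.map d) := by
    have := (S.card_fiber_pos (S.map d)).ne'
    rw [transfer_apply, mul_inv_cancel_left₀ (by exact_mod_cast this)]
  have h3 : ‖f d‖ ≤ ‖((S.fiber (S.map d)).card : ℂ) * S.transfer f (S.map d)‖ := by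
    rw [← h2]
    have h0 : 0 ≤ f d := hf d
    have e1 := Complex.re_le_re h1
    have e3 : ‖f d‖ = (f d).re := by
      conv_rhs => rw [Complex.eq_coe_norm_of_nonneg h0]
      simp
    rw [e3]
    exact e1.trans (Complex.re_le_norm _)
  refine h3.trans ?_
  rw [norm_mul, Complex.norm_natCast]
  gcongr
  · exact_mod_cast hK _
  · exact ContinuousMap.norm_coe_le_norm _ _

theorem transferPow_endo_mul (k : ℕ) (a f : C(C, ℂ)) :
    (S.transfer ^ k) ((S.endo ^ k) a * f) = a * (S.transfer ^ k) f := by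
  induction k generalizing a f with
  | zero => rfl
  | succ k ih =>
    have e1 : (S.endo ^ (k + 1)) a = S.endo ((S.endo ^ k) a) := by rw [pow_succ']; rfl
    have e2 : ∀ g, (S.transfer ^ (k + 1)) g = (S.transfer ^ k) (S.transfer g) := by
      intro g; rw [pow_succ]; rfl
    rw [e1, e2, e2, transfer_endo_mul, ih]

theorem transferPow_star (k : ℕ) (f : C(C, ℂ)) :
    (S.transfer ^ k) (star f) = star ((S.transfer ^ k) f) := by
  induction k generalizing f with
  | zero => rfl
  | succ k ih =>
    have e2 : ∀ g, (S.transfer ^ (k + 1)) g = (S.transfer ^ k) (S.transfer g) := by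
      intro g; rw [pow_succ]; rfl
    rw [e2, e2, transfer_star, ih]

theorem transferPow_nonneg (k : ℕ) {f : C(C, ℂ)} (hf : 0 ≤ f) : 0 ≤ (S.transfer ^ k) f := by
  induction k generalizing f with
  | zero => exact hf
  | succ k ih =>
    have e2 : ∀ g, (S.transfer ^ (k + 1)) g = (S.transfer ^ k) (S.transfer g) := by
      intro g; rw [pow_succ]; rfl
    rw [e2]
    exact ih (S.transfer_nonneg hf)

theorem exists_norm_le_transferPow (k : ℕ) : ∃ K : ℝ, 0 ≤ K ∧ ∀ f : C(C, ℂ), 0 ≤ f →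
    ‖f‖ ≤ K * ‖(S.transfer ^ k) f‖ := by
  obtain ⟨K, hK, h⟩ := S.exists_norm_le_transfer
  refine ⟨K ^ k, by positivity, ?_⟩
  induction k with
  | zero => intro f _; simp
  | succ k ih =>
    intro f hf
    have e2 : ∀ g, (S.transfer ^ (k + 1)) g = (S.transfer ^ k) (S.transfer g) := by
      intro g; rw [pow_succ]; rfl
    calc ‖f‖ ≤ K * ‖S.transfer f‖ := h f hf
      _ ≤ K * (K ^ k * ‖(S.transfer ^ k) (S.transfer f)‖) := by
        gcongr
        exact ih _ (S.transfer_nonneg hf)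
      _ = _ := by rw [e2]; ring

end ExelSystem
section

/-- A (complete) Hilbert `C(C)`-module. As `C(C)` is commutative, the right action
`x · f` is written `f • x`. -/
structure HilbertModule (C : Type w) [TopologicalSpace C] [CompactSpace C] where
  /-- the underlying space -/
  carrier : Type u
  [instNormedAddCommGroup : NormedAddCommGroup carrier]
  [instNormedSpace : NormedSpace ℂ carrier]
  [instSMul : SMul C(C, ℂ) carrier]
  [instCStarModule : CStarModule C(C, ℂ) carrier]
  [instCompleteSpace : CompleteSpace carrier]

/-- A pre-inner-product `C(C)`-module: the inner product may be degenerate. -/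
structure PreHilbertModule (C : Type w) [TopologicalSpace C] [CompactSpace C] where
  /-- the underlying space -/
  carrier : Type u
  [instAddCommGroup : AddCommGroup carrier]
  [instModule : Module ℂ carrier]
  [instSMul : SMul C(C, ℂ) carrier]
  [instInner : Inner C(C, ℂ) carrier]
  inner_add_right (x y z : carrier) :
    inner C(C, ℂ) x (y + z) = inner C(C, ℂ) x y + inner C(C, ℂ) x z
  inner_smul_right_complex (a : ℂ) (x y : carrier) :
    inner C(C, ℂ) x (a • y) = a • inner C(C, ℂ) x y
  inner_smul_right (a : C(C, ℂ)) (x y : carrier) :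
    inner C(C, ℂ) x (a • y) = a * inner C(C, ℂ) x y
  star_inner (x y : carrier) : star (inner C(C, ℂ) x y) = inner C(C, ℂ) y x
  inner_self_nonneg (x : carrier) : 0 ≤ inner C(C, ℂ) x x

attribute [instance] HilbertModule.instNormedAddCommGroup HilbertModule.instNormedSpace
  HilbertModule.instSMul HilbertModule.instCStarModule HilbertModule.instCompleteSpace
  PreHilbertModule.instAddCommGroup PreHilbertModule.instModule
  PreHilbertModule.instSMul PreHilbertModule.instInner

variable {C : Type w} [TopologicalSpace C] [CompactSpace C]

theorem isClosed_nonneg_continuousMap : IsClosed {f : C(C, ℂ) | 0 ≤ f} := by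
  have : {f : C(C, ℂ) | 0 ≤ f} = ⋂ c, {f : C(C, ℂ) | 0 ≤ f c} := by
    ext f; simp [ContinuousMap.le_def]
  rw [this]
  exact isClosed_iInter fun c => isClosed_le continuous_const (by fun_prop)

namespace PreHilbertModule

variable (P : PreHilbertModule.{u} C)

theorem inner_add_left (x y z : P.carrier) :
    inner C(C, ℂ) (x + y) z = inner C(C, ℂ) x z + inner C(C, ℂ) y z := by
  rw [← P.star_inner z (x + y), P.inner_add_right, star_add, P.star_inner, P.star_inner]

theorem inner_smul_left_complex (a : ℂ) (x y : P.carrier) :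
    inner C(C, ℂ) (a • x) y = star a • inner C(C, ℂ) x y := by
  rw [← P.star_inner y (a • x), P.inner_smul_right_complex, star_smul, P.star_inner]

theorem inner_smul_left (a : C(C, ℂ)) (x y : P.carrier) :
    inner C(C, ℂ) (a • x) y = star a * inner C(C, ℂ) x y := by
  rw [← P.star_inner y (a • x), P.inner_smul_right, star_mul, P.star_inner, mul_comm]

theorem inner_sub_right (x y z : P.carrier) :
    inner C(C, ℂ) x (y - z) = inner C(C, ℂ) x y - inner C(C, ℂ) x z := by
  rw [eq_sub_iff_add_eq, ← P.inner_add_right, sub_add_cancel]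

theorem inner_sub_left (x y z : P.carrier) :
    inner C(C, ℂ) (x - y) z = inner C(C, ℂ) x z - inner C(C, ℂ) y z := by
  rw [eq_sub_iff_add_eq, ← P.inner_add_left, sub_add_cancel]

/-- Evaluation of the inner product at a point is a scalar-valued pre-inner product. -/
@[reducible] def core (c : C) : PreInnerProductSpace.Core ℂ P.carrier where
  inner x y := inner C(C, ℂ) x y c
  conj_inner_symm x y := by
    rw [← P.star_inner y x]; rfl
  re_inner_nonneg x := (Complex.nonneg_iff.mp (P.inner_self_nonneg x c)).1
  add_left x y z := by rw [P.inner_add_left]; rfl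
  smul_left x y r := by rw [P.inner_smul_left_complex]; rfl

theorem norm_inner_self_apply (x : P.carrier) (c : C) :
    ‖inner C(C, ℂ) x x c‖ = (inner C(C, ℂ) x x c).re := by
  have h : 0 ≤ inner C(C, ℂ) x x c := P.inner_self_nonneg x c
  conv_rhs => rw [Complex.eq_coe_norm_of_nonneg h]
  simp

/-- The seminorm `‖x‖ = ‖⟨x, x⟩‖ ^ (1/2)`. -/
instance : Norm P.carrier := ⟨fun x => √‖inner C(C, ℂ) x x‖⟩

theorem norm_def (x : P.carrier) : ‖x‖ = √‖inner C(C, ℂ) x x‖ := rfl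

theorem norm_sq (x : P.carrier) : ‖x‖ ^ 2 = ‖inner C(C, ℂ) x x‖ := by
  rw [norm_def, Real.sq_sqrt (norm_nonneg _)]

theorem pointwise_norm_le (x : P.carrier) (c : C) : √(inner C(C, ℂ) x x c).re ≤ ‖x‖ := by
  rw [norm_def, ← norm_inner_self_apply]
  exact Real.sqrt_le_sqrt (ContinuousMap.norm_coe_le_norm _ _)

theorem norm_le_of_pointwise (x : P.carrier) {M : ℝ} (hM : 0 ≤ M)
    (h : ∀ c, √(inner C(C, ℂ) x x c).re ≤ M) : ‖x‖ ≤ M := by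
  rw [norm_def, Real.sqrt_le_left hM, ContinuousMap.norm_le _ (by positivity)]
  intro c
  rw [norm_inner_self_apply, ← Real.sqrt_le_left hM]
  exact h c

theorem norm_inner_le (x y : P.carrier) : ‖inner C(C, ℂ) x y‖ ≤ ‖x‖ * ‖y‖ := by
  have hx : 0 ≤ ‖x‖ := Real.sqrt_nonneg _
  have hy : 0 ≤ ‖y‖ := Real.sqrt_nonneg _
  rw [ContinuousMap.norm_le _ (mul_nonneg hx hy)]
  intro c
  refine (@InnerProductSpace.Core.norm_inner_le_norm ℂ P.carrier _ _ _ (P.core c) x y).trans ?_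
  exact mul_le_mul (P.pointwise_norm_le x c) (P.pointwise_norm_le y c) (Real.sqrt_nonneg _) hx

theorem seminormedCore : SeminormedSpace.Core ℂ P.carrier where
  norm_nonneg _ := Real.sqrt_nonneg _
  norm_smul z x := by
    rw [norm_def, norm_def, P.inner_smul_right_complex, P.inner_smul_left_complex, smul_smul,
      norm_smul, Real.sqrt_mul (norm_nonneg _)]
    congr 1
    simp
  norm_triangle x y := by
    refine P.norm_le_of_pointwise _ (add_nonneg (Real.sqrt_nonneg _) (Real.sqrt_nonneg _)) ?_
    intro c
    let _ := P.core c
    have h := @norm_add_le P.carrier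
      (InnerProductSpace.Core.toSeminormedAddCommGroup (𝕜 := ℂ)).toSeminormedAddGroup x y
    exact h.trans (add_le_add (P.pointwise_norm_le x c) (P.pointwise_norm_le y c))

instance : SeminormedAddCommGroup P.carrier := SeminormedAddCommGroup.ofCore P.seminormedCore

instance : NormedSpace ℂ P.carrier where
  norm_smul_le z x := (P.seminormedCore.norm_smul z x).le

theorem norm_smul_sub_le (a : C(C, ℂ)) (x y : P.carrier) :
    ‖a • x - a • y‖ ≤ ‖a‖ * ‖x - y‖ := by
  have h : inner C(C, ℂ) (a • x - a • y) (a • x - a • y) =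
      (star a * a) * inner C(C, ℂ) (x - y) (x - y) := by
    simp only [inner_sub_left, inner_sub_right, inner_smul_left, inner_smul_right]
    ring
  rw [norm_def, norm_def, h]
  calc √‖star a * a * inner C(C, ℂ) (x - y) (x - y)‖
      ≤ √(‖a‖ ^ 2 * ‖inner C(C, ℂ) (x - y) (x - y)‖) := by
        refine Real.sqrt_le_sqrt ((norm_mul_le _ _).trans ?_)
        rw [CStarRing.norm_star_mul_self, sq]
    _ = _ := by rw [Real.sqrt_mul (by positivity), Real.sqrt_sq (norm_nonneg _)]

instance : UniformContinuousConstSMul C(C, ℂ) P.carrier where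
  uniformContinuous_const_smul a := by
    refine (LipschitzWith.of_dist_le_mul (K := ‖a‖₊) fun x y => ?_).uniformContinuous
    rw [dist_eq_norm, dist_eq_norm]
    exact P.norm_smul_sub_le a x y

/-- The inner product as a continuous sesquilinear map. -/
def innerSL : P.carrier →L⋆[ℂ] P.carrier →L[ℂ] C(C, ℂ) :=
  LinearMap.mkContinuous₂ (LinearMap.mk₂'ₛₗ (starRingEnd ℂ) (RingHom.id ℂ)
    (fun x y : P.carrier => inner C(C, ℂ) x y) P.inner_add_left
    (fun a x y => P.inner_smul_left_complex a x y) P.inner_add_right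
    (fun a x y => P.inner_smul_right_complex a x y)) 1 fun x y => by
      simpa using P.norm_inner_le x y

theorem continuous_inner :
    Continuous fun p : P.carrier × P.carrier => inner C(C, ℂ) p.1 p.2 := by
  have : (fun p : P.carrier × P.carrier => inner C(C, ℂ) p.1 p.2) =
      fun p => P.innerSL p.1 p.2 := rfl
  rw [this]
  fun_prop

open UniformSpace

/-- The Hausdorff completion of a pre-inner-product module (as a type). -/
def Compl : Type u := Completion P.carrier

instance : NormedAddCommGroup P.Compl := inferInstanceAs (NormedAddCommGroup (Completion P.carrier))
instance : NormedSpace ℂ P.Compl := inferInstanceAs (NormedSpace ℂ (Completion P.carrier))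
instance : SMul C(C, ℂ) P.Compl := inferInstanceAs (SMul C(C, ℂ) (Completion P.carrier))
instance : UniformContinuousConstSMul C(C, ℂ) P.Compl :=
  inferInstanceAs (UniformContinuousConstSMul C(C, ℂ) (Completion P.carrier))
instance : CompleteSpace P.Compl := inferInstanceAs (CompleteSpace (Completion P.carrier))
/-- The inner product of the completion: the continuous extension of the given one. -/
instance : Inner C(C, ℂ) P.Compl := inferInstanceAs (Inner C(C, ℂ) (Completion P.carrier))

/-- The canonical map into the completion. -/
def toCompl : P.carrier →ₗ[ℂ] P.Compl := (Completion.toComplₗᵢ (𝕜 := ℂ)).toLinearMap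

theorem norm_toCompl (x : P.carrier) : ‖P.toCompl x‖ = ‖x‖ := Completion.norm_coe x

theorem continuous_toCompl : Continuous P.toCompl := Completion.continuous_coe _

theorem denseRange_toCompl : DenseRange P.toCompl := Completion.denseRange_coe

theorem toCompl_smul (a : C(C, ℂ)) (x : P.carrier) : P.toCompl (a • x) = a • P.toCompl x :=
  Completion.coe_smul a x

theorem inner_toCompl (x y : P.carrier) :
    inner C(C, ℂ) (P.toCompl x) (P.toCompl y) = inner C(C, ℂ) x y :=
  (Completion.isDenseInducing_coe.prodMap Completion.isDenseInducing_coe).extend_eq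
    (f := Function.uncurry (inner C(C, ℂ))) P.continuous_inner (x, y)

theorem continuous_inner_compl :
    Continuous fun p : P.Compl × P.Compl => inner C(C, ℂ) p.1 p.2 := by
  let inner' : P.carrier →+ P.carrier →+ C(C, ℂ) :=
    AddMonoidHom.mk' (fun x => (P.innerSL x).toLinearMap.toAddMonoidHom)
      fun x y => by ext z; simp
  have h : Continuous fun p : P.carrier × P.carrier => inner' p.1 p.2 := P.continuous_inner
  exact (Completion.isDenseInducing_toCompl P.carrier).extend_Z_bilin
    (Completion.isDenseInducing_toCompl P.carrier) h

@[fun_prop]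
theorem Continuous_inner_compl {α : Type*} [TopologicalSpace α] {f g : α → P.Compl}
    (hf : Continuous f) (hg : Continuous g) :
    Continuous fun a => inner C(C, ℂ) (f a) (g a) :=
  P.continuous_inner_compl.comp (hf.prodMk hg)

@[elab_as_elim]
theorem compl_induction {p : P.Compl → Prop} (hp : IsClosed {x | p x})
    (h : ∀ x, p (P.toCompl x)) (x : P.Compl) : p x :=
  Completion.induction_on x hp h

theorem norm_compl (x : P.Compl) : ‖x‖ = √‖inner C(C, ℂ) x x‖ := by
  induction x using P.compl_induction with
  | hp => exact isClosed_eq (by fun_prop) (by fun_prop)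
  | h x => rw [norm_toCompl, inner_toCompl, norm_def]

theorem continuous_smul_compl (a : C(C, ℂ)) : Continuous fun x : P.Compl => a • x :=
  (uniformContinuous_const_smul a).continuous

theorem inner_smul_compl (a : C(C, ℂ)) (x y : P.Compl) :
    inner C(C, ℂ) x (a • y) = a * inner C(C, ℂ) x y := by
  have ha := P.continuous_smul_compl a
  induction x using P.compl_induction with
  | hp =>
    exact isClosed_eq (Continuous_inner_compl P continuous_id continuous_const)
      (continuous_const.mul (Continuous_inner_compl P continuous_id continuous_const))
  | h x =>
  induction y using P.compl_induction with
  | hp =>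
    exact isClosed_eq (Continuous_inner_compl P continuous_const ha)
      (continuous_const.mul (Continuous_inner_compl P continuous_const continuous_id))
  | h y => rw [← toCompl_smul, inner_toCompl, inner_toCompl, P.inner_smul_right]

theorem inner_smul_complex_compl (a : ℂ) (x y : P.Compl) :
    inner C(C, ℂ) x (a • y) = a • inner C(C, ℂ) x y := by
  have ha : Continuous fun y : P.Compl => a • y := continuous_const_smul a
  have hb : Continuous fun f : C(C, ℂ) => a • f := continuous_const_smul a
  induction x using P.compl_induction with
  | hp =>
    exact isClosed_eq (Continuous_inner_compl P continuous_id continuous_const)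
      (hb.comp (Continuous_inner_compl P continuous_id continuous_const))
  | h x =>
  induction y using P.compl_induction with
  | hp =>
    exact isClosed_eq (Continuous_inner_compl P continuous_const ha)
      (hb.comp (Continuous_inner_compl P continuous_const continuous_id))
  | h y => rw [← map_smul, inner_toCompl, inner_toCompl, P.inner_smul_right_complex]

instance : CStarModule C(C, ℂ) P.Compl where
  inner_add_right := by
    intro x y z
    induction x using P.compl_induction with
    | hp => exact isClosed_eq (by fun_prop) (by fun_prop)
    | h x =>
    induction y using P.compl_induction with
    | hp => exact isClosed_eq (by fun_prop) (by fun_prop)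
    | h y =>
    induction z using P.compl_induction with
    | hp => exact isClosed_eq (by fun_prop) (by fun_prop)
    | h z =>
    rw [← map_add, inner_toCompl, inner_toCompl, inner_toCompl, P.inner_add_right]
  inner_self_nonneg := by
    intro x
    induction x using P.compl_induction with
    | hp =>
      have hc : Continuous fun x : P.Compl => inner C(C, ℂ) x x := by fun_prop
      exact isClosed_nonneg_continuousMap.preimage hc
    | h x => rw [inner_toCompl]; exact P.inner_self_nonneg x
  inner_self := by
    intro x
    constructor
    · intro h
      rw [← norm_eq_zero, norm_compl, h]; simp
    · intro h
      have := P.norm_compl x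
      rwa [h, norm_zero, eq_comm, Real.sqrt_eq_zero (norm_nonneg _), norm_eq_zero, ← h] at this
  inner_op_smul_right := P.inner_smul_compl _ _ _
  inner_smul_right_complex := P.inner_smul_complex_compl _ _ _
  star_inner := by
    intro x y
    induction x using P.compl_induction with
    | hp => exact isClosed_eq (by fun_prop) (by fun_prop)
    | h x =>
    induction y using P.compl_induction with
    | hp => exact isClosed_eq (by fun_prop) (by fun_prop)
    | h y =>
    rw [inner_toCompl, inner_toCompl, P.star_inner]
  norm_eq_sqrt_norm_inner_self := P.norm_compl

/-- The completion of a pre-inner-product module, as a Hilbert module. -/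
def completion : HilbertModule.{u} C where
  carrier := P.Compl

/-- The canonical map of a pre-inner-product module into its completion. -/
def toCompletion : P.carrier →ₗ[ℂ] P.completion.carrier := P.toCompl

theorem toCompletion_smul (a : C(C, ℂ)) (x : P.carrier) : P.toCompletion (a • x) = a • P.toCompletion x := P.toCompl_smul a x

theorem inner_toCompletion (x y : P.carrier) :
    inner C(C, ℂ) (P.toCompletion x) (P.toCompletion y) = inner C(C, ℂ) x y := P.inner_toCompl x y

end PreHilbertModule

/-- An inner-product preserving module map between Hilbert modules (it need not be adjointable
nor surjective; a Hilbert-module isomorphism is a surjective one). -/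
structure IPMap (X : HilbertModule.{u} C) (Y : HilbertModule.{v} C) extends
    X.carrier →ₗ[ℂ] Y.carrier where
  map_action (a : C(C, ℂ)) (x : X.carrier) : toFun (a • x) = a • toFun x
  inner_map (x y : X.carrier) : inner C(C, ℂ) (toFun x) (toFun y) = inner C(C, ℂ) x y

namespace IPMap

variable {X : HilbertModule.{u} C} {Y : HilbertModule.{v} C}

instance : CoeFun (IPMap X Y) fun _ => X.carrier → Y.carrier := ⟨fun T => T.toLinearMap⟩

/-- `T` has an adjoint. -/
def IsAdjointable (T : IPMap X Y) : Prop :=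
  ∃ T' : Y.carrier → X.carrier, ∀ x y, inner C(C, ℂ) (T x) y = inner C(C, ℂ) x (T' y)

theorem norm_map (T : IPMap X Y) (x : X.carrier) : ‖T x‖ = ‖x‖ := by
  rw [CStarModule.norm_eq_sqrt_norm_inner_self (A := C(C, ℂ)),
    CStarModule.norm_eq_sqrt_norm_inner_self (A := C(C, ℂ)) x]
  congr 2
  exact T.inner_map x x

end IPMap

namespace PreHilbertModule

variable (P : PreHilbertModule.{u} C) {Z : HilbertModule.{v} C}

theorem norm_eq_of_inner (f : P.carrier →ₗ[ℂ] Z.carrier)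
    (hf : ∀ x y, inner C(C, ℂ) (f x) (f y) = inner C(C, ℂ) x y) (x : P.carrier) :
    ‖f x‖ = ‖x‖ := by
  rw [CStarModule.norm_eq_sqrt_norm_inner_self (A := C(C, ℂ)), hf]; rfl

theorem uniformContinuous_of_inner (f : P.carrier →ₗ[ℂ] Z.carrier)
    (hf : ∀ x y, inner C(C, ℂ) (f x) (f y) = inner C(C, ℂ) x y) : UniformContinuous f := by
  refine (LipschitzWith.of_dist_le_mul (K := 1) fun x y => ?_).uniformContinuous
  rw [dist_eq_norm, dist_eq_norm, ← map_sub, P.norm_eq_of_inner f hf]; simp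

theorem continuous_smul_hilbert (a : C(C, ℂ)) : Continuous fun z : Z.carrier => a • z := by
  refine (LipschitzWith.of_dist_le_mul (K := ‖a‖₊) fun x y => ?_).continuous
  rw [dist_eq_norm, dist_eq_norm]
  have h : inner C(C, ℂ) (a • x - a • y) (a • x - a • y) =
      (star a * a) * inner C(C, ℂ) (x - y) (x - y) := by
    simp only [CStarModule.inner_sub_left, CStarModule.inner_sub_right,
      CStarModule.inner_op_smul_left, CStarModule.inner_op_smul_right]
    ring
  rw [CStarModule.norm_eq_sqrt_norm_inner_self (A := C(C, ℂ)), h,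
    CStarModule.norm_eq_sqrt_norm_inner_self (A := C(C, ℂ)) (x - y)]
  calc √‖star a * a * inner C(C, ℂ) (x - y) (x - y)‖
      ≤ √(‖a‖ ^ 2 * ‖inner C(C, ℂ) (x - y) (x - y)‖) := by
        refine Real.sqrt_le_sqrt ((norm_mul_le _ _).trans ?_)
        rw [CStarRing.norm_star_mul_self, sq]
    _ = _ := by rw [Real.sqrt_mul (by positivity), Real.sqrt_sq (norm_nonneg _)]; rfl

open UniformSpace

/-- The continuous extension of a map to the completion. -/
def extend (f : P.carrier → Z.carrier) : P.Compl → Z.carrier := Completion.extension f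

theorem continuous_extend (f : P.carrier → Z.carrier) : Continuous (P.extend f) :=
  Completion.continuous_extension

theorem extend_toCompl {f : P.carrier → Z.carrier} (hf : UniformContinuous f) (x : P.carrier) :
    P.extend f (P.toCompl x) = f x :=
  Completion.extension_coe hf x

/-- The continuous extension to the completion of an inner-product preserving module map. -/
def lift (f : P.carrier →ₗ[ℂ] Z.carrier) (hA : ∀ (a : C(C, ℂ)) x, f (a • x) = a • f x)
    (hf : ∀ x y, inner C(C, ℂ) (f x) (f y) = inner C(C, ℂ) x y) :
    IPMap P.completion Z :=
  have hu := P.uniformContinuous_of_inner f hf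
  have hc := P.continuous_extend f
  have hcz : Continuous fun p : Z.carrier × Z.carrier => inner C(C, ℂ) p.1 p.2 :=
    CStarModule.continuous_inner
  { toFun := P.extend f
    map_add' := fun (x y : P.Compl) => by
      change P.extend f (x + y) = P.extend f x + P.extend f y
      induction x using P.compl_induction with
      | hp => exact isClosed_eq (by fun_prop) (by fun_prop)
      | h x =>
      induction y using P.compl_induction with
      | hp => exact isClosed_eq (by fun_prop) (by fun_prop)
      | h y => rw [← map_add, extend_toCompl P hu, extend_toCompl P hu, extend_toCompl P hu, map_add]
    map_smul' := fun a (x : P.Compl) => by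
      change P.extend f (a • x) = a • P.extend f x
      induction x using P.compl_induction with
      | hp => exact isClosed_eq (hc.comp (continuous_const_smul a)) (hc.const_smul a)
      | h x =>
        rw [← map_smul, extend_toCompl P hu, extend_toCompl P hu, map_smul]
    map_action := fun a (x : P.Compl) => by
      have h1 := P.continuous_smul_compl a
      have h2 := continuous_smul_hilbert (Z := Z) a
      change P.extend f (a • x) = a • P.extend f x
      induction x using P.compl_induction with
      | hp => exact isClosed_eq (hc.comp h1) (h2.comp hc)
      | h x => rw [← toCompl_smul, extend_toCompl P hu, extend_toCompl P hu, hA]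
    inner_map := fun (x y : P.Compl) => by
      change inner C(C, ℂ) (P.extend f x) (P.extend f y) = inner C(C, ℂ) x y
      induction x using P.compl_induction with
      | hp => exact isClosed_eq (hcz.comp (hc.prodMk continuous_const)) (by fun_prop)
      | h x =>
      induction y using P.compl_induction with
      | hp => exact isClosed_eq (hcz.comp (continuous_const.prodMk hc)) (by fun_prop)
      | h y => rw [extend_toCompl P hu, extend_toCompl P hu, hf, inner_toCompl] }

theorem lift_toCompletion (f : P.carrier →ₗ[ℂ] Z.carrier)
    (hA : ∀ (a : C(C, ℂ)) x, f (a • x) = a • f x)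
    (hf : ∀ x y, inner C(C, ℂ) (f x) (f y) = inner C(C, ℂ) x y) (x : P.carrier) :
    P.lift f hA hf (P.toCompletion x) = f x :=
  P.extend_toCompl (P.uniformContinuous_of_inner f hf) x

end PreHilbertModule

end

theorem ExelSystem.norm_transferPow_le {C : Type w} [TopologicalSpace C] [CompactSpace C]
    [T2Space C] (S : ExelSystem C) (k : ℕ) (f : C(C, ℂ)) : ‖(S.transfer ^ k) f‖ ≤ ‖f‖ := by
  induction k generalizing f with
  | zero => exact le_rfl
  | succ k ih =>
    have e2 : (S.transfer ^ (k + 1)) f = (S.transfer ^ k) (S.transfer f) := by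
      rw [pow_succ]; rfl
    rw [e2]
    refine (ih _).trans ?_
    rw [ContinuousMap.norm_le _ (norm_nonneg _)]
    intro c
    have hn : (0 : ℝ) < (S.fiber c).card := by exact_mod_cast S.card_fiber_pos c
    rw [S.transfer_apply, norm_mul, norm_inv, Complex.norm_natCast, inv_mul_le_iff₀ hn]
    refine (norm_sum_le _ _).trans ((Finset.sum_le_sum fun d _ =>
      ContinuousMap.norm_coe_le_norm f d).trans ?_)
    simp

namespace HilbertModule

variable {C : Type w} [TopologicalSpace C] [CompactSpace C] (X : HilbertModule.{u} C)

theorem ext_inner {x y : X.carrier}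
    (h : ∀ z, inner C(C, ℂ) z x = inner C(C, ℂ) z y) : x = y := by
  rw [← sub_eq_zero, ← CStarModule.inner_self (A := C(C, ℂ)), CStarModule.inner_sub_right, h,
    sub_self]

theorem action_add (a : C(C, ℂ)) (x y : X.carrier) : a • (x + y) = a • x + a • y :=
  X.ext_inner fun z => by simp [mul_add]

theorem add_action (a b : C(C, ℂ)) (x : X.carrier) : (a + b) • x = a • x + b • x :=
  X.ext_inner fun z => by simp [add_mul]

theorem mul_action (a b : C(C, ℂ)) (x : X.carrier) : (a * b) • x = a • b • x :=
  X.ext_inner fun z => by simp [mul_assoc]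

theorem action_smul (a : C(C, ℂ)) (t : ℂ) (x : X.carrier) : a • t • x = t • a • x :=
  X.ext_inner fun z => by simp

theorem smul_action (t : ℂ) (a : C(C, ℂ)) (x : X.carrier) : (t • a) • x = t • a • x :=
  X.ext_inner fun z => by simp

variable (C) in
/-- The free Hilbert module `C(C)` over `C(C)`, with `⟨f, g⟩ = f* g`. -/
def self : HilbertModule.{w} C where
  carrier := C(C, ℂ)

end HilbertModule

namespace ExelSystem

variable {C : Type w} [TopologicalSpace C] [CompactSpace C] [T2Space C] (S : ExelSystem C)

section Twist

variable (k : ℕ) (X : HilbertModule.{u} C)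

/-- The underlying space of `X_{L^k}`, which is that of `X`. -/
def Twist (_ : ExelSystem C) (_ : ℕ) (X : HilbertModule.{u} C) : Type u := X.carrier

instance : AddCommGroup (S.Twist k X) := inferInstanceAs (AddCommGroup X.carrier)
instance : Module ℂ (S.Twist k X) := inferInstanceAs (Module ℂ X.carrier)

/-- The identity map from `X` to `X_{L^k}`. -/
def twistEquiv : X.carrier ≃ₗ[ℂ] S.Twist k X := LinearEquiv.refl ℂ X.carrier

/-- The module action of `X_{L^k}` is `x · α^k(f)`. -/
instance : SMul C(C, ℂ) (S.Twist k X) :=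
  ⟨fun f x => S.twistEquiv k X ((S.endo ^ k) f • (S.twistEquiv k X).symm x)⟩

/-- The inner product of `X_{L^k}` is `L^k(⟨x, y⟩)`. -/
instance : Inner C(C, ℂ) (S.Twist k X) :=
  ⟨fun x y => (S.transfer ^ k)
    (inner C(C, ℂ) ((S.twistEquiv k X).symm x) ((S.twistEquiv k X).symm y))⟩

instance : Norm (S.Twist k X) := ⟨fun x => √‖inner C(C, ℂ) x x‖⟩

theorem inner_twist (x y : S.Twist k X) : inner C(C, ℂ) x y = (S.transfer ^ k)
    (inner C(C, ℂ) ((S.twistEquiv k X).symm x) ((S.twistEquiv k X).symm y)) := rfl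

theorem twistEquiv_symm_smul (f : C(C, ℂ)) (x : S.Twist k X) :
    (S.twistEquiv k X).symm (f • x) = (S.endo ^ k) f • (S.twistEquiv k X).symm x := rfl

instance : CStarModule C(C, ℂ) (S.Twist k X) where
  inner_add_right {x y z} := by simp [inner_twist]
  inner_self_nonneg {x} := S.transferPow_nonneg k CStarModule.inner_self_nonneg
  inner_self {x} := by
    constructor
    · intro h
      obtain ⟨K, -, hK⟩ := S.exists_norm_le_transferPow k
      have := hK (inner C(C, ℂ) ((S.twistEquiv k X).symm x) ((S.twistEquiv k X).symm x))
        CStarModule.inner_self_nonneg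
      rw [← inner_twist, h, norm_zero, mul_zero, norm_le_zero_iff, CStarModule.inner_self] at this
      simpa using this
    · rintro rfl
      simp [inner_twist]
  inner_op_smul_right {a x y} := by
    rw [inner_twist, twistEquiv_symm_smul, CStarModule.inner_op_smul_right, transferPow_endo_mul]
    rfl
  inner_smul_right_complex {t x y} := by simp [inner_twist]
  star_inner x y := by rw [inner_twist, ← transferPow_star, CStarModule.star_inner]; rfl
  norm_eq_sqrt_norm_inner_self _ := rfl

instance : NormedAddCommGroup (S.Twist k X) := CStarModule.normedAddCommGroup C(C, ℂ)

instance : NormedSpace ℂ (S.Twist k X) := .ofCore (CStarModule.normedSpaceCore C(C, ℂ))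

instance : CompleteSpace (S.Twist k X) := by
  obtain ⟨K, hK0, hK⟩ := S.exists_norm_le_transferPow k
  let e : X.carrier ≃L[ℂ] S.Twist k X :=
    (S.twistEquiv k X).toContinuousLinearEquivOfBounds 1 (√K)
      (fun x => by
        rw [one_mul, CStarModule.norm_eq_sqrt_norm_inner_self (A := C(C, ℂ)),
          CStarModule.norm_eq_sqrt_norm_inner_self (A := C(C, ℂ)) x]
        exact Real.sqrt_le_sqrt (S.norm_transferPow_le k _))
      (fun x => by
        rw [CStarModule.norm_eq_sqrt_norm_inner_self (A := C(C, ℂ)),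
          CStarModule.norm_eq_sqrt_norm_inner_self (A := C(C, ℂ)) x, ← Real.sqrt_mul hK0]
        exact Real.sqrt_le_sqrt (hK _ CStarModule.inner_self_nonneg))
  exact (completeSpace_congr (e := e.toEquiv) e.isUniformEmbedding).mp inferInstance

/-- The Hilbert module `X_{L^k}`: the space `X` with module action `x · α^k(f)` and inner product
`L^k(⟨x, y⟩)`. -/
def twist : HilbertModule.{u} C where
  carrier := S.Twist k X

/-- The identity map from `X` to `X_{L^k}`. -/
def tw : X.carrier ≃ₗ[ℂ] (S.twist k X).carrier := S.twistEquiv k X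

theorem tw_symm_smul (f : C(C, ℂ)) (x : (S.twist k X).carrier) :
    (S.tw k X).symm (f • x) = (S.endo ^ k) f • (S.tw k X).symm x := rfl

theorem inner_tw (x y : (S.twist k X).carrier) : inner C(C, ℂ) x y =
    (S.transfer ^ k) (inner C(C, ℂ) ((S.tw k X).symm x) ((S.tw k X).symm y)) := rfl

end Twist

/-- Exel's correspondence `M_L`, as a right Hilbert module: the space `C(C)` with module action
`m · f = m α(f)` and inner product `⟨m, n⟩ = L(m* n)`. -/
def ML : HilbertModule.{w} C := S.twist 1 (HilbertModule.self C)

/-- The element of `M_L` given by a function. -/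
def ofFun : C(C, ℂ) ≃ₗ[ℂ] S.ML.carrier := S.tw 1 (HilbertModule.self C)

/-- The left action of `C(C)` on `M_L` by multiplication. -/
def leftMul (a : C(C, ℂ)) (m : S.ML.carrier) : S.ML.carrier := S.ofFun (a * S.ofFun.symm m)

theorem ofFun_symm_smul (a : C(C, ℂ)) (m : S.ML.carrier) :
    S.ofFun.symm (a • m) = S.endo a * S.ofFun.symm m := rfl

theorem inner_ML (m n : S.ML.carrier) :
    inner C(C, ℂ) m n = S.transfer (S.ofFun.symm n * star (S.ofFun.symm m)) := rfl

section Tensor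

variable (X : HilbertModule.{u} C)

/-- The linear functional `y ⊗ n ↦ ⟨m, ⟨x, y⟩ · n⟩` on `X ⊙ M_L`. -/
def tensorInnerAux (x : X.carrier) (m : S.ML.carrier) :
    X.carrier ⊗[ℂ] S.ML.carrier →ₗ[ℂ] C(C, ℂ) :=
  TensorProduct.lift <| LinearMap.mk₂ ℂ
    (fun (y : X.carrier) (n : S.ML.carrier) =>
      inner C(C, ℂ) m (S.leftMul (inner C(C, ℂ) x y) n))
    (by intros; simp [leftMul, add_mul])
    (by intros; simp [leftMul])
    (by intros; simp [leftMul, mul_add])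
    (by intros; simp [leftMul])

theorem tensorInnerAux_tmul (x y : X.carrier) (m n : S.ML.carrier) :
    S.tensorInnerAux X x m (y ⊗ₜ n) = inner C(C, ℂ) m (S.leftMul (inner C(C, ℂ) x y) n) := rfl

/-- The sesquilinear form on the algebraic tensor product `X ⊙ M_L` with
`⟨x ⊗ m, y ⊗ n⟩ = ⟨m, ⟨x, y⟩ · n⟩`. -/
def tensorInner : X.carrier ⊗[ℂ] S.ML.carrier →ₗ⋆[ℂ] X.carrier ⊗[ℂ] S.ML.carrier →ₗ[ℂ] C(C, ℂ) :=
  TensorProduct.lift <| LinearMap.mk₂'ₛₗ (starRingEnd ℂ) (starRingEnd ℂ) (S.tensorInnerAux X)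
    (by intros; ext; simp [tensorInnerAux_tmul, leftMul, add_mul])
    (by intros; ext; simp [tensorInnerAux_tmul, leftMul])
    (by intros; ext; simp [tensorInnerAux_tmul])
    (by intros; ext; simp [tensorInnerAux_tmul])

theorem tensorInner_tmul (x y : X.carrier) (m n : S.ML.carrier) :
    S.tensorInner X (x ⊗ₜ m) (y ⊗ₜ n) = inner C(C, ℂ) m (S.leftMul (inner C(C, ℂ) x y) n) := rfl

/-- The map `X ⊙ M_L → X`, `x ⊗ f ↦ x · f`. -/
def tensorToModule : X.carrier ⊗[ℂ] S.ML.carrier →ₗ[ℂ] X.carrier :=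
  TensorProduct.lift <| LinearMap.mk₂ ℂ (fun x m => S.ofFun.symm m • x)
    (fun _ _ _ => X.action_add _ _ _)
    (fun _ _ _ => X.action_smul _ _ _)
    (fun _ _ _ => by rw [map_add, X.add_action])
    (fun _ _ _ => by rw [map_smul, X.smul_action])

theorem tensorInner_eq (s t : X.carrier ⊗[ℂ] S.ML.carrier) :
    S.tensorInner X s t =
      S.transfer (inner C(C, ℂ) (S.tensorToModule X s) (S.tensorToModule X t)) := by
  induction s with
  | zero => simp
  | add s s' hs hs' => simp [hs, hs']
  | tmul x m =>
    induction t with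
    | zero => simp
    | add t t' ht ht' => simp [ht, ht']
    | tmul y n =>
      rw [tensorInner_tmul, inner_ML]
      simp only [leftMul, LinearEquiv.symm_apply_apply, tensorToModule, TensorProduct.lift.tmul,
        LinearMap.mk₂_apply, CStarModule.inner_op_smul_right, CStarModule.inner_op_smul_left]
      congr 1
      ring

/-- The right action of `a` on `M_L` as a linear map. -/
def rightMul (a : C(C, ℂ)) : S.ML.carrier →ₗ[ℂ] S.ML.carrier where
  toFun m := a • m
  map_add' := S.ML.action_add a
  map_smul' := S.ML.action_smul a

theorem tensorToModule_rightMul (a : C(C, ℂ)) (t : X.carrier ⊗[ℂ] S.ML.carrier) :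
    S.tensorToModule X ((S.rightMul a).lTensor X.carrier t) = S.endo a • S.tensorToModule X t := by
  induction t with
  | zero =>
    rw [map_zero, map_zero]
    exact X.ext_inner fun z => by simp
  | add s t hs ht => rw [map_add, map_add, hs, ht, map_add, X.action_add]
  | tmul x m =>
    simp only [LinearMap.lTensor_tmul, tensorToModule, TensorProduct.lift.tmul, LinearMap.mk₂_apply]
    rw [← X.mul_action]
    rfl

/-- The algebraic tensor product `X ⊙ M_L` with right action `(x ⊗ m) · a = x ⊗ (m · a)` and
pre-inner product `⟨x ⊗ m, y ⊗ n⟩ = ⟨m, ⟨x, y⟩ · n⟩`. -/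
def preTensor : PreHilbertModule.{max u w} C where
  carrier := X.carrier ⊗[ℂ] S.ML.carrier
  instSMul := ⟨fun a t => (S.rightMul a).lTensor X.carrier t⟩
  instInner := ⟨fun s t => S.tensorInner X s t⟩
  inner_add_right s t t' := map_add _ _ _
  inner_smul_right_complex a s t := map_smul _ _ _
  inner_smul_right a s t := by
    change S.tensorInner X s ((S.rightMul a).lTensor X.carrier t) = a * S.tensorInner X s t
    rw [tensorInner_eq, tensorInner_eq, tensorToModule_rightMul, CStarModule.inner_op_smul_right,
      transfer_endo_mul]
  star_inner s t := by
    change star (S.tensorInner X s t) = S.tensorInner X t s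
    rw [tensorInner_eq, tensorInner_eq, ← transfer_star, CStarModule.star_inner]
  inner_self_nonneg s := by
    change 0 ≤ S.tensorInner X s s
    rw [tensorInner_eq]
    exact S.transfer_nonneg CStarModule.inner_self_nonneg

/-- The internal tensor product `X ⊗_{C(C)} M_L`. -/
def tensor : HilbertModule.{max u w} C := (S.preTensor X).completion

/-- The elementary tensor `x ⊗ m` in `X ⊗_{C(C)} M_L`. -/
def tmul (x : X.carrier) (m : S.ML.carrier) : (S.tensor X).carrier :=
  (S.preTensor X).toCompletion (x ⊗ₜ[ℂ] m)

/-- The identification `X ⊗_{C(C)} M_L → X_L` induced by `x ⊗ f ↦ x · f`. -/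
def tensorTwist : IPMap (S.tensor X) (S.twist 1 X) :=
  (S.preTensor X).lift ((S.tw 1 X).toLinearMap ∘ₗ S.tensorToModule X)
    (fun a t => by
      apply (S.tw 1 X).symm.injective
      rw [tw_symm_smul]
      exact S.tensorToModule_rightMul X a t)
    (fun s t => (S.tensorInner_eq X s t).symm)

theorem tensorTwist_tmul (x : X.carrier) (m : S.ML.carrier) :
    S.tensorTwist X (S.tmul X x m) = S.tw 1 X (S.ofFun.symm m • x) :=
  (S.preTensor X).lift_toCompletion _ _ _ _

variable {X} {Z : HilbertModule.{v} C}

theorem tensorInner_rTensor (T : IPMap X Z) (s t : X.carrier ⊗[ℂ] S.ML.carrier) :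
    S.tensorInner Z (T.toLinearMap.rTensor _ s) (T.toLinearMap.rTensor _ t) =
      S.tensorInner X s t := by
  induction s with
  | zero => simp
  | add s s' hs hs' => simp only [map_add, LinearMap.add_apply, hs, hs']
  | tmul x m =>
    induction t with
    | zero => simp
    | add t t' ht ht' => simp only [map_add, ht, ht']
    | tmul y n =>
      rw [LinearMap.rTensor_tmul, LinearMap.rTensor_tmul, tensorInner_tmul, tensorInner_tmul]
      congr 2
      exact T.inner_map x y

/-- `T ⊗ id : X ⊗ M_L → Z ⊗ M_L` for an inner-product preserving map `T : X → Z`. -/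
def tensorMap (T : IPMap X Z) : IPMap (S.tensor X) (S.tensor Z) :=
  (S.preTensor X).lift (Z := (S.preTensor Z).completion)
    ((S.preTensor Z).toCompletion ∘ₗ T.toLinearMap.rTensor S.ML.carrier)
    (fun a t => by
      have h : T.toLinearMap.rTensor S.ML.carrier ((S.rightMul a).lTensor X.carrier t) =
          (S.rightMul a).lTensor Z.carrier (T.toLinearMap.rTensor S.ML.carrier t) :=
        LinearMap.congr_fun ((LinearMap.rTensor_comp_lTensor _ _ _).trans
          (LinearMap.lTensor_comp_rTensor _ _ _).symm) t
      exact (congrArg (S.preTensor Z).toCompletion h).trans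
        ((S.preTensor Z).toCompletion_smul a _))
    (fun s t => ((S.preTensor Z).inner_toCompletion _ _).trans (S.tensorInner_rTensor T s t))

theorem tensorMap_tmul (T : IPMap X Z) (x : X.carrier) (m : S.ML.carrier) :
    S.tensorMap T (S.tmul X x m) = S.tmul Z (T x) m :=
  (S.preTensor X).lift_toCompletion _ _ _ _

end Tensor

end ExelSystem

namespace HilbertModule

section Limit

variable {C : Type w} [TopologicalSpace C] [CompactSpace C]
  {X : ℕ → HilbertModule.{u} C} (T : ∀ k, IPMap (X k) (X (k + 1)))

/-- The composite `T_{j-1} ∘ ⋯ ∘ T_i : X_i → X_j`. -/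
def transition (i j : ℕ) (h : i ≤ j) : (X i).carrier →ₗ[ℂ] (X j).carrier :=
  Nat.leRec (motive := fun j _ => (X i).carrier →ₗ[ℂ] (X j).carrier) LinearMap.id
    (fun {j} _ f => (T j).toLinearMap ∘ₗ f) h

theorem transition_self (i : ℕ) (x : (X i).carrier) : transition T i i le_rfl x = x := by
  rw [transition, Nat.leRec_self]; rfl

theorem transition_succ (i j : ℕ) (h : i ≤ j) (x : (X i).carrier) :
    transition T i (j + 1) (Nat.le_succ_of_le h) x = T j (transition T i j h x) := by
  rw [transition, Nat.leRec_succ]; rfl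

instance directedSystem :
    DirectedSystem (fun k => (X k).carrier) fun i j h => transition T i j h where
  map_self i x := transition_self T i x
  map_map {k j i} hij hjk x := by
    induction k, hjk using Nat.le_induction with
    | base => rw [transition_self]
    | succ k hjk ih =>
      rw [transition_succ T j k hjk, ih, transition_succ T i k (hij.trans hjk)]

theorem transition_action (a : C(C, ℂ)) (i j : ℕ) (h : i ≤ j) (x : (X i).carrier) :
    transition T i j h (a • x) = a • transition T i j h x := by
  induction j, h using Nat.le_induction with
  | base => rw [transition_self, transition_self]
  | succ j h ih =>
    rw [transition_succ T i j h, ih, transition_succ T i j h]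
    exact (T j).map_action a _

theorem inner_transition (i j : ℕ) (h : i ≤ j) (x y : (X i).carrier) :
    inner C(C, ℂ) (transition T i j h x) (transition T i j h y) = inner C(C, ℂ) x y := by
  induction j, h using Nat.le_induction with
  | base => rw [transition_self, transition_self]
  | succ j h ih =>
    rw [transition_succ, transition_succ, ← ih]
    exact (T j).inner_map _ _

/-- The algebraic direct limit of a sequence of Hilbert modules and inner-product preserving maps:
the quotient of the disjoint union of the `X_k` which identifies `x ∈ X_k` with
`T_k x ∈ X_{k+1}`, with the induced module structure and inner product. -/
def preLimit : PreHilbertModule.{u} C where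
  carrier := DirectLimit (fun k => (X k).carrier) (transition T)
  instSMul := ⟨fun a => DirectLimit.map (transition T) (transition T) (fun _ x => a • x)
    fun i j h x => transition_action T a i j h x⟩
  instInner := ⟨DirectLimit.lift₂ (transition T) (transition T) (fun _ x y => inner C(C, ℂ) x y)
    fun i j h x y => (inner_transition T i j h x y).symm⟩
  inner_add_right x y z := by
    induction x, y, z using DirectLimit.induction₃ with
    | ih i x y z =>
    simp only [inner, DirectLimit.add_def, DirectLimit.lift₂_def]
    exact CStarModule.inner_add_right
  inner_smul_right_complex a x y := by
    induction x, y using DirectLimit.induction₂ with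
    | ih i x y =>
    simp only [inner, DirectLimit.smul_def, DirectLimit.lift₂_def]
    exact CStarModule.inner_smul_right_complex
  inner_smul_right a x y := by
    induction x, y using DirectLimit.induction₂ with
    | ih i x y =>
    simp only [inner, HSMul.hSMul, SMul.smul, DirectLimit.map_def, DirectLimit.lift₂_def]
    exact CStarModule.inner_op_smul_right
  star_inner x y := by
    induction x, y using DirectLimit.induction₂ with
    | ih i x y =>
    simp only [inner, DirectLimit.lift₂_def]
    exact CStarModule.star_inner _ _
  inner_self_nonneg x := by
    induction x using DirectLimit.induction with
    | ih i x =>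
    simp only [inner, DirectLimit.lift₂_def]
    exact CStarModule.inner_self_nonneg

/-- The direct limit `X_∞` of a sequence of Hilbert modules and inner-product preserving maps: the
completion of the algebraic direct limit. -/
def limit : HilbertModule.{u} C := (preLimit T).completion

/-- The class of `x ∈ X_k` in the algebraic direct limit. -/
def toPreLimit (k : ℕ) (x : (X k).carrier) : (preLimit T).carrier :=
  (Quotient.mk _ ⟨k, x⟩ : DirectLimit (fun k => (X k).carrier) (transition T))

theorem toPreLimit_add (k : ℕ) (x y : (X k).carrier) :
    toPreLimit T k (x + y) = toPreLimit T k x + toPreLimit T k y :=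
  (DirectLimit.add_def (G := fun k => (X k).carrier) (f := transition T) k x y).symm

theorem inner_toPreLimit (k : ℕ) (x y : (X k).carrier) :
    inner C(C, ℂ) (toPreLimit T k x) (toPreLimit T k y) = inner C(C, ℂ) x y :=
  DirectLimit.lift₂_def ..

/-- The canonical map `ι^k : X_k → X_∞`. -/
def toLimit (k : ℕ) : IPMap (X k) (limit T) where
  toFun x := (preLimit T).toCompletion (toPreLimit T k x)
  map_add' x y := by rw [toPreLimit_add]; exact map_add _ _ _
  map_smul' a x := (preLimit T).toCompletion.map_smul a (toPreLimit T k x)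
  map_action a x := (preLimit T).toCompletion_smul a (toPreLimit T k x)
  inner_map x y := ((preLimit T).inner_toCompletion _ _).trans (inner_toPreLimit T k x y)

theorem toLimit_succ (k : ℕ) (x : (X k).carrier) :
    toLimit T (k + 1) (T k x) = toLimit T k x := by
  have h : transition T k (k + 1) (Nat.le_succ k) x = T k x := by
    rw [transition_succ T k k le_rfl, transition_self]
  rw [← h]
  exact congrArg (preLimit T).toCompletion
    (DirectLimit.mk_apply (F := fun k => (X k).carrier) (f := transition T) k (k + 1) x (Nat.le_succ k))

end Limit

section Complemented

variable {C : Type w} [TopologicalSpace C] [CompactSpace C] {X : HilbertModule.{u} C}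

/-- A closed submodule of a Hilbert module. -/
def IsClosedSubmodule (V : Submodule ℂ X.carrier) : Prop :=
  IsClosed (V : Set X.carrier) ∧ ∀ (a : C(C, ℂ)), ∀ x ∈ V, a • x ∈ V

/-- `V` is a complemented submodule of the Hilbert module `W` (both given as closed submodules of
`X`): every element of `W` is the sum of an element of `V` and one of `W` orthogonal to `V`. -/
def IsComplementedIn (V W : Submodule ℂ X.carrier) : Prop :=
  IsClosedSubmodule V ∧ IsClosedSubmodule W ∧ V ≤ W ∧
    ∀ x ∈ W, ∃ v ∈ V, ∃ n ∈ W, (∀ v' ∈ V, inner C(C, ℂ) v' n = 0) ∧ v + n = x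

/-- The submodules `V_k` form a projective multi-resolution analysis of the submodule `W` of `X`,
with respect to the dilation operator `D` on `X`. -/
structure IsProjectiveMRA (D : X.carrier ≃ₗ[ℂ] X.carrier) (W : Submodule ℂ X.carrier)
    (V : ℕ → Submodule ℂ X.carrier) : Prop where
  complemented_zero : IsComplementedIn (V 0) W
  eq_preimage (k : ℕ) : (V k : Set X.carrier) = D^[k] ⁻¹' (V 0)
  complemented_succ (k : ℕ) : IsComplementedIn (V k) (V (k + 1))
  le (k : ℕ) : V k ≤ W
  dense : (W : Set X.carrier) ⊆ closure (⋃ k, (V k : Set X.carrier))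

end Complemented

end HilbertModule

namespace ExelSystem

variable {C : Type w} [TopologicalSpace C] [CompactSpace C] [T2Space C] (S : ExelSystem C)

/-- The identity map from `(X_{L^k})_L` to `X_{L^{k+1}}`. -/
def twSucc (k : ℕ) (X : HilbertModule.{u} C) :
    (S.twist 1 (S.twist k X)).carrier ≃ₗ[ℂ] (S.twist (k + 1) X).carrier :=
  (S.tw 1 (S.twist k X)).symm.trans ((S.tw k X).symm.trans (S.tw (k + 1) X))

/-- The tensor powers `M_L^{⊗ k}`, with `M_L^{⊗ 0} = C(C)`, `M_L^{⊗ 1} = M_L` and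
`M_L^{⊗ (k+1)} = M_L^{⊗ k} ⊗ M_L` for `k ≥ 1`. -/
def tensorPow : ℕ → HilbertModule.{w} C
  | 0 => HilbertModule.self C
  | 1 => S.ML
  | k + 2 => S.tensor (tensorPow (k + 1))

/-- A function as an element of `M_L^{⊗ 0} = C(C)`. -/
def scalar (a : C(C, ℂ)) : (S.tensorPow 0).carrier := a

/-- A filter: an element `m` of `M_L` with `⟨m, m⟩ = 1`. -/
def IsFilter (m : S.ML.carrier) : Prop := inner C(C, ℂ) m m = (1 : C(C, ℂ))

/-- For a filter `m`, the map `S_m : C(C) → M_L`, `a ↦ m · a`. -/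
def filterMapZero {m : S.ML.carrier} (hm : S.IsFilter m) : IPMap (HilbertModule.self C) S.ML where
  toFun a := (show C(C, ℂ) from a) • m
  map_add' a b := S.ML.add_action a b m
  map_smul' t a := S.ML.smul_action t a m
  map_action a b := S.ML.mul_action a b m
  inner_map a b := by
    rw [CStarModule.inner_op_smul_right, CStarModule.inner_op_smul_left, hm, one_mul]
    rfl

/-- For a filter `m`, the map `M_L → M_L ⊗ M_L`, `n ↦ m ⊗ n`. -/
def filterMapOne {m : S.ML.carrier} (hm : S.IsFilter m) : IPMap S.ML (S.tensor S.ML) where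
  toFun n := S.tmul S.ML m n
  map_add' n n' := by
    rw [tmul, TensorProduct.tmul_add]; exact map_add _ _ _
  map_smul' t n := by
    rw [tmul, TensorProduct.tmul_smul]; exact map_smul _ _ _
  map_action a n := (S.preTensor S.ML).toCompletion_smul a (m ⊗ₜ[ℂ] n)
  inner_map n n' := by
    refine ((S.preTensor S.ML).inner_toCompletion _ _).trans ?_
    refine (S.tensorInner_tmul S.ML m m n n').trans ?_
    rw [hm, leftMul, one_mul, LinearEquiv.apply_symm_apply]

/-- For a filter `m`, the maps `T_k : M_L^{⊗ k} → M_L^{⊗ (k+1)}`, `T_0 a = m · a` and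
`T_k n = m ⊗ n` for `k ≥ 1`, that is, `T_k (n_1 ⊗ ⋯ ⊗ n_k) = m ⊗ n_1 ⊗ ⋯ ⊗ n_k`. -/
def filterMap {m : S.ML.carrier} (hm : S.IsFilter m) : (k : ℕ) → IPMap (S.tensorPow k) (S.tensorPow (k + 1))
  | 0 => S.filterMapZero hm
  | 1 => S.filterMapOne hm
  | k + 2 => S.tensorMap (filterMap hm (k + 1))

/-- `(X, D, φ)` is a scaling function for the filter `m`: `D : X → X ⊗ M_L` is a Hilbert-module
isomorphism, `⟨φ, φ⟩ = 1` and `D φ = φ ⊗ m`. -/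
structure IsScalingFunction (m : S.ML.carrier) (X : HilbertModule.{u} C)
    (D : IPMap X (S.tensor X)) (φ : X.carrier) : Prop where
  surjective : Function.Surjective D
  inner_self : inner C(C, ℂ) φ φ = (1 : C(C, ℂ))
  map_eq : D φ = S.tmul X φ m

end ExelSystem

end

-- Both halves are instances of one situation: a sequence `X k` of Hilbert modules with
-- inner-product preserving maps `T k`, and unitaries `E k` from `X k ⊗ M_L` onto `X (k + 1)`
-- satisfying `T (k + 1) ∘ E k = E (k + 1) ∘ (T k ⊗ id)`. In the first half `X k` is `Y_{L^k}`, in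
-- the second it is `M_L^{⊗ k}`.
--
-- Tensoring with `M_L` therefore only shifts the sequence, and the limit should absorb it. The maps
-- `(ι^k ⊗ id) ∘ (E k)⁻¹` are compatible and glue to `R`. The range of the isometry `R` is closed,
-- and under `X_∞ ⊗ M_L = (X_∞)_L` it contains every `ι^k(X k)`, so `R` is onto
-- (`exists_limit_tensor`).
--
-- The hypotheses on `D` say that it is a unitary `D'` from `X` onto `X_L = X ⊗ M_L`. Starting from
-- `Q₀`, the recursion `q (k + 1) = D'⁻¹ ∘ (q k ⊗ id) ∘ (E k)⁻¹` gives maps `q k : X k → X`. They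
-- are compatible because `D Q₀ = Q₀ T`, and they glue to `Q`. The recursion also yields `V_{k+1} =
-- D⁻¹(V_k)` (`exists_limit_projectiveMRA`).
--
-- Complements are the delicate point, since a closed submodule of a Hilbert module need not have
-- one. Adjointability of `T 0` propagates to every `T k` (`isAdjointable_of_compatible`), which
-- complements `V_k` in `V_{k+1}`. That `V_0` is complemented in the whole of `W` follows because
-- `V_0 + V_0^⊥` is closed and contains every `V_k` (`isComplementedIn_of_dense`).

universe u₁ u₂ u₃

noncomputable section

/-! ### Inner-product preserving maps: composites, inverses and ranges. -/

namespace IPMap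

variable {C : Type w} [TopologicalSpace C] [CompactSpace C]
  {X : HilbertModule.{u₁} C} {Y : HilbertModule.{u₂} C} {Z : HilbertModule.{u₃} C}

theorem map_act (T : IPMap X Y) (a : C(C, ℂ)) (x : X.carrier) : T (a • x) = a • T x :=
  T.map_action a x

theorem inner_apply (T : IPMap X Y) (x y : X.carrier) :
    inner C(C, ℂ) (T x) (T y) = inner C(C, ℂ) x y :=
  T.inner_map x y

/-- An inner-product preserving module map as a linear isometry. -/
def toLinearIsometry (T : IPMap X Y) : X.carrier →ₗᵢ[ℂ] Y.carrier := ⟨T.toLinearMap, T.norm_map⟩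

theorem isometry (T : IPMap X Y) : Isometry T := T.toLinearIsometry.isometry

theorem injective (T : IPMap X Y) : Function.Injective T := T.isometry.injective

theorem continuous (T : IPMap X Y) : Continuous T := T.isometry.continuous

theorem isClosed_range (T : IPMap X Y) : IsClosed (Set.range T) :=
  T.isometry.isClosedEmbedding.isClosed_range

/-- The identity map. -/
def id (X : HilbertModule.{u₁} C) : IPMap X X where
  toLinearMap := LinearMap.id
  map_action _ _ := rfl
  inner_map _ _ := rfl

/-- The composite of two inner-product preserving module maps. -/
def comp (S : IPMap Y Z) (T : IPMap X Y) : IPMap X Z where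
  toLinearMap := S.toLinearMap ∘ₗ T.toLinearMap
  map_action a x := (congrArg S (T.map_act a x)).trans (S.map_act a (T x))
  inner_map x y := (S.inner_apply (T x) (T y)).trans (T.inner_apply x y)

theorem comp_apply (S : IPMap Y Z) (T : IPMap X Y) (x : X.carrier) : S.comp T x = S (T x) := rfl

/-- The inverse of a surjective inner-product preserving module map. -/
def inverse (T : IPMap X Y) (hT : Function.Surjective T) : IPMap Y X :=
  let e := LinearEquiv.ofBijective T.toLinearMap ⟨T.injective, hT⟩
  have he (y : Y.carrier) : T (e.symm y) = y := e.apply_symm_apply y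
  { toLinearMap := e.symm.toLinearMap
    map_action := fun a y => T.injective <| by
      change T (e.symm (a • y)) = T (a • e.symm y)
      rw [T.map_act, he, he]
    inner_map := fun x y => by
      change inner C(C, ℂ) (e.symm x) (e.symm y) = _
      rw [← T.inner_apply, he, he] }

theorem apply_inverse (T : IPMap X Y) (hT : Function.Surjective T) (y : Y.carrier) :
    T (T.inverse hT y) = y :=
  (LinearEquiv.ofBijective T.toLinearMap ⟨T.injective, hT⟩).apply_symm_apply y

theorem inverse_apply (T : IPMap X Y) (hT : Function.Surjective T) (x : X.carrier) :
    T.inverse hT (T x) = x :=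
  T.injective (T.apply_inverse hT (T x))

theorem surjective_inverse (T : IPMap X Y) (hT : Function.Surjective T) :
    Function.Surjective (T.inverse hT) :=
  fun x => ⟨T x, T.inverse_apply hT x⟩

theorem range_isClosedSubmodule (T : IPMap X Y) :
    HilbertModule.IsClosedSubmodule (LinearMap.range T.toLinearMap) := by
  refine ⟨T.isClosed_range, ?_⟩
  rintro a _ ⟨x, rfl⟩
  exact ⟨a • x, T.map_act a x⟩

/-- The range of an adjointable inner-product preserving map is complemented. -/
theorem IsAdjointable.isComplementedIn_range_comp {T : IPMap X Y} (hT : T.IsAdjointable)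
    (S : IPMap Y Z) : HilbertModule.IsComplementedIn (LinearMap.range (S.comp T).toLinearMap)
      (LinearMap.range S.toLinearMap) := by
  obtain ⟨T', hT'⟩ := hT
  refine ⟨(S.comp T).range_isClosedSubmodule, S.range_isClosedSubmodule, ?_, ?_⟩
  · rintro _ ⟨x, rfl⟩
    exact ⟨T x, rfl⟩
  · rintro _ ⟨y, rfl⟩
    -- `T T'` is the projection onto the range of `T`, because `T` preserves inner products. The
    -- defining identity of `T'` suffices; its linearity plays no role.
    refine ⟨S (T (T' y)), ⟨T' y, rfl⟩, S (y - T (T' y)), ⟨_, rfl⟩, ?_, ?_⟩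
    · rintro _ ⟨x, rfl⟩
      change inner C(C, ℂ) (S (T x)) (S (y - T (T' y))) = 0
      rw [S.inner_apply, CStarModule.inner_sub_right, hT', T.inner_apply, sub_self]
    · rw [← map_add, add_sub_cancel]

end IPMap

namespace HilbertModule

/-! ### Orthogonal complements and complementation in a closure. -/

section Complemented

variable {C : Type w} [TopologicalSpace C] [CompactSpace C] {X : HilbertModule.{u} C}

theorem norm_sq_eq (x : X.carrier) : ‖x‖ ^ 2 = ‖inner C(C, ℂ) x x‖ := by
  rw [CStarModule.norm_eq_sqrt_norm_inner_self (A := C(C, ℂ)), Real.sq_sqrt (norm_nonneg _)]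

/-- Orthogonality gives `⟨x + y, x + y⟩ = ⟨x, x⟩ + ⟨y, y⟩ ≥ ⟨x, x⟩` in `C(C)`, and the norm is
monotone on positive elements. Pythagoras holds for the `C(C)`-valued inner products, not for the
norms. -/
theorem norm_le_norm_add_of_inner_eq_zero {x y : X.carrier} (h : inner C(C, ℂ) x y = 0) :
    ‖x‖ ≤ ‖x + y‖ := by
  have h' : inner C(C, ℂ) y x = 0 := by rw [← CStarModule.star_inner, h, star_zero]
  refine le_of_sq_le_sq ?_ (norm_nonneg _)
  rw [norm_sq_eq, norm_sq_eq]
  refine CStarAlgebra.norm_le_norm_of_nonneg_of_le CStarModule.inner_self_nonneg ?_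
  rw [CStarModule.inner_add_right, CStarModule.inner_add_left, CStarModule.inner_add_left, h, h',
    add_zero, zero_add]
  exact le_add_of_nonneg_right CStarModule.inner_self_nonneg

/-- The orthogonal complement of a subspace. -/
def orthogonal (V : Submodule ℂ X.carrier) : Submodule ℂ X.carrier where
  carrier := {x | ∀ v ∈ V, inner C(C, ℂ) v x = 0}
  add_mem' hx hy v hv := by rw [CStarModule.inner_add_right, hx v hv, hy v hv, add_zero]
  zero_mem' v _ := by simp
  smul_mem' t x hx v hv := by rw [CStarModule.inner_smul_right_complex, hx v hv, smul_zero]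

theorem mem_orthogonal {V : Submodule ℂ X.carrier} {x : X.carrier} :
    x ∈ orthogonal V ↔ ∀ v ∈ V, inner C(C, ℂ) v x = 0 := Iff.rfl

theorem isClosed_orthogonal (V : Submodule ℂ X.carrier) :
    IsClosed (orthogonal V : Set X.carrier) := by
  have h : (orthogonal V : Set X.carrier) = ⋂ v ∈ V, {x | inner C(C, ℂ) v x = 0} := by
    ext x; simp [mem_orthogonal]
  have hc : Continuous fun p : X.carrier × X.carrier => inner C(C, ℂ) p.1 p.2 :=
    CStarModule.continuous_inner
  rw [h]
  exact isClosed_biInter fun v _ =>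
    isClosed_eq (hc.comp (continuous_const.prodMk continuous_id)) continuous_const

/-- Addition from `V × V^⊥` to `X` is bounded below, since neither summand exceeds the sum in norm.
Its domain is complete, so its range is closed. The sum need not be all of `X`. -/
theorem isClosed_sup_orthogonal {V : Submodule ℂ X.carrier} (hV : IsClosed (V : Set X.carrier)) :
    IsClosed ((V ⊔ orthogonal V : Submodule ℂ X.carrier) : Set X.carrier) := by
  have : CompleteSpace V := hV.completeSpace_coe
  have : CompleteSpace (orthogonal V) := (isClosed_orthogonal V).completeSpace_coe
  let f : V × orthogonal V →L[ℂ] X.carrier :=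
    V.subtypeL.coprod (orthogonal V).subtypeL
  -- The constant is 1 because the product carries the maximum norm, so each component can be
  -- bounded separately.
  have hf : AntilipschitzWith 1 f := by
    refine AddMonoidHomClass.antilipschitz_of_bound f fun p => ?_
    have h : inner C(C, ℂ) (p.1 : X.carrier) (p.2 : X.carrier) = 0 := p.2.2 _ p.1.2
    have h' : inner C(C, ℂ) (p.2 : X.carrier) (p.1 : X.carrier) = 0 := by
      rw [← CStarModule.star_inner, h, star_zero]
    rw [NNReal.coe_one, one_mul]
    refine max_le (norm_le_norm_add_of_inner_eq_zero h) ?_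
    change ‖(p.2 : X.carrier)‖ ≤ ‖(p.1 : X.carrier) + p.2‖
    rw [add_comm]
    exact norm_le_norm_add_of_inner_eq_zero h'
  have h : ((V ⊔ orthogonal V : Submodule ℂ X.carrier) : Set X.carrier) = Set.range f := by
    ext x
    simp only [SetLike.mem_coe, Submodule.mem_sup, Set.mem_range]
    constructor
    · rintro ⟨y, hy, z, hz, rfl⟩
      exact ⟨(⟨y, hy⟩, ⟨z, hz⟩), rfl⟩
    · rintro ⟨p, rfl⟩
      exact ⟨p.1, p.1.2, p.2, p.2.2, rfl⟩
  rw [h]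
  exact hf.isClosed_range f.uniformContinuous

/-- The first submodule of an increasing sequence of successively complemented submodules is
complemented in the closure of the union. -/
theorem isComplementedIn_of_dense {V : ℕ → Submodule ℂ X.carrier} {W : Submodule ℂ X.carrier}
    (hW : IsClosedSubmodule W) (hV : ∀ k, IsComplementedIn (V k) (V (k + 1)))
    (hle : ∀ k, V k ≤ W) (hd : (W : Set X.carrier) ⊆ closure (⋃ k, (V k : Set X.carrier))) :
    IsComplementedIn (V 0) W := by
  have hmono : Monotone V := monotone_nat_of_le_succ fun k => (hV k).2.2.1
  -- Passing from `V k` to `V (k + 1)` adds only vectors orthogonal to `V k`, hence to the smaller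
  -- `V 0`.
  have hsup (k : ℕ) : V k ≤ V 0 ⊔ orthogonal (V 0) := by
    induction k with
    | zero => exact le_sup_left
    | succ k ih =>
      intro x hx
      obtain ⟨v, hv, n, -, hn, rfl⟩ := (hV k).2.2.2 x hx
      exact add_mem (ih hv) (Submodule.mem_sup_right fun v' hv' => hn v' (hmono k.zero_le hv'))
  refine ⟨(hV 0).1, hW, hle 0, fun x hx => ?_⟩
  have hx' : x ∈ V 0 ⊔ orthogonal (V 0) :=
    closure_minimal (Set.iUnion_subset hsup) (isClosed_sup_orthogonal (hV 0).1.1) (hd hx)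
  obtain ⟨v, hv, n, hn, rfl⟩ := Submodule.mem_sup.mp hx'
  -- The orthogonal part lies in `W` as the difference of an element of `W` and one of `V 0 ≤ W`.
  exact ⟨v, hv, n, by simpa using sub_mem hx (hle 0 hv), hn, rfl⟩

end Complemented

/-! ### Universal property of the direct limit. -/

section Limit

variable {C : Type w} [TopologicalSpace C] [CompactSpace C] {Z : HilbertModule.{v} C}
  {X : ℕ → HilbertModule.{u} C} (T : ∀ k, IPMap (X k) (X (k + 1)))

theorem dense_iUnion_range_toLimit : Dense (⋃ k, Set.range (toLimit T k)) := by
  have h : DenseRange (preLimit T).toCompletion := (preLimit T).denseRange_toCompl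
  refine h.mono ?_
  rintro _ ⟨x, rfl⟩
  obtain ⟨k, x, rfl⟩ := DirectLimit.exists_eq_mk (transition T) x
  exact Set.mem_iUnion.mpr ⟨k, x, rfl⟩

/-- Since `ι^k = ι^{k+1} ∘ T k`, dropping the zeroth term loses nothing. This matters because `R` is
prescribed only on the ranges of the `ι^{k+1}`. -/
theorem iUnion_range_toLimit_subset :
    (⋃ k, Set.range (toLimit T k)) ⊆ ⋃ k, Set.range (toLimit T (k + 1)) := by
  refine Set.iUnion_subset fun k => ?_
  rintro _ ⟨x, rfl⟩
  exact Set.mem_iUnion.mpr ⟨k, T k x, toLimit_succ T k x⟩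

/-- Maps out of the direct limit which agree on the images of the later terms are equal. -/
theorem limit_map_ext {f g : IPMap (limit T) Z}
    (h : ∀ k x, f (toLimit T (k + 1) x) = g (toLimit T (k + 1) x)) (z : (limit T).carrier) :
    f z = g z := by
  have hd := (dense_iUnion_range_toLimit T).mono (iUnion_range_toLimit_subset T)
  refine congrFun (Continuous.ext_on hd f.continuous g.continuous ?_) z
  intro _ hz
  obtain ⟨k, x, rfl⟩ := Set.mem_iUnion.mp hz
  exact h k x

theorem apply_transition (g : ∀ k, IPMap (X k) Z) (hg : ∀ k x, g (k + 1) (T k x) = g k x) (i j : ℕ) (h : i ≤ j) (x : (X i).carrier) :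
    g j (transition T i j h x) = g i x := by
  induction j, h using Nat.le_induction with
  | base => rw [transition_self]
  | succ j h ih => rw [transition_succ T i j h, hg, ih]

variable (g : ∀ k, IPMap (X k) Z) (hg : ∀ k x, g (k + 1) (T k x) = g k x)

/-- The linear map on the algebraic direct limit given by a compatible family of maps. -/
def preLimitLift : (preLimit T).carrier →ₗ[ℂ] Z.carrier :=
  DirectLimit.Module.lift ℂ ℕ (fun k => (X k).carrier) (transition T)
    (fun k => (g k).toLinearMap) (apply_transition T g hg)

/-- The map out of the direct limit given by a compatible family of maps. -/
def limitLift : IPMap (limit T) Z :=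
  (preLimit T).lift (preLimitLift T g hg)
    (fun a x => by
      obtain ⟨k, x, rfl⟩ := DirectLimit.exists_eq_mk (transition T) x
      exact (g k).map_act a x)
    (fun x y => by
      obtain ⟨k, x, y, rfl, rfl⟩ := DirectLimit.exists_eq_mk₂ (transition T) x y
      exact ((g k).inner_apply x y).trans (inner_toPreLimit T k x y).symm)

theorem limitLift_toLimit (k : ℕ) (x : (X k).carrier) :
    limitLift T g hg (toLimit T k x) = g k x :=
  (preLimit T).lift_toCompletion _ _ _ _

theorem range_subset_closure_iUnion (f : IPMap (limit T) Z) :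
    (LinearMap.range f.toLinearMap : Set Z.carrier) ⊆
      closure (⋃ k, (LinearMap.range (f.comp (toLimit T k)).toLinearMap : Set Z.carrier)) := by
  rintro _ ⟨z, rfl⟩
  refine map_mem_closure f.continuous (dense_iUnion_range_toLimit T z) ?_
  intro _ hz
  obtain ⟨k, x, rfl⟩ := Set.mem_iUnion.mp hz
  exact Set.mem_iUnion.mpr ⟨k, x, rfl⟩

end Limit

end HilbertModule

end

noncomputable section

namespace ExelSystem

variable {C : Type w} [TopologicalSpace C] [CompactSpace C] [T2Space C] (S : ExelSystem C)

/-! ### Maps on `X ⊗ M_L` and their description on `X_L`. -/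

section Tensor

variable {X : HilbertModule.{u₁} C} {Y : HilbertModule.{u₂} C}

/-- Elementary tensors span a dense subspace of the completion, and inner-product preserving maps
are continuous. -/
theorem tensor_map_ext {f g : IPMap (S.tensor X) Y}
    (h : ∀ x m, f (S.tmul X x m) = g (S.tmul X x m)) (z : (S.tensor X).carrier) : f z = g z := by
  have hd : DenseRange (S.preTensor X).toCompletion := (S.preTensor X).denseRange_toCompl
  refine congrFun (Continuous.ext_on hd f.continuous g.continuous ?_) z
  rintro _ ⟨t, rfl⟩
  have ht : f.toLinearMap ∘ₗ (S.preTensor X).toCompletion =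
      g.toLinearMap ∘ₗ (S.preTensor X).toCompletion :=
    TensorProduct.ext' (R := ℂ) (M := X.carrier) (N := S.ML.carrier) h
  exact LinearMap.congr_fun ht t

theorem surjective_tensorTwist (X : HilbertModule.{u} C) :
    Function.Surjective (S.tensorTwist X) := by
  intro x
  refine ⟨S.tmul X ((S.tw 1 X).symm x) (S.ofFun 1), ?_⟩
  rw [tensorTwist_tmul, LinearEquiv.symm_apply_apply]
  -- The unit law for the action is read off from inner products with an arbitrary `z`.
  have h : (1 : C(C, ℂ)) • (S.tw 1 X).symm x = (S.tw 1 X).symm x := X.ext_inner fun z => by simp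
  rw [h, LinearEquiv.apply_symm_apply]

/-- A map of Hilbert modules, regarded as a map `X_{L^k} → Y_{L^k}`. -/
def twistMap (k : ℕ) (T : IPMap X Y) : IPMap (S.twist k X) (S.twist k Y) where
  toLinearMap := (S.tw k Y).toLinearMap ∘ₗ T.toLinearMap ∘ₗ (S.tw k X).symm.toLinearMap
  map_action a x := (S.tw k Y).symm.injective (T.map_act ((S.endo ^ k) a) ((S.tw k X).symm x))
  inner_map _ _ := congrArg (S.transfer ^ k) (T.inner_apply _ _)

theorem twistMap_apply (k : ℕ) (T : IPMap X Y) (x : (S.twist k X).carrier) :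
    S.twistMap k T x = S.tw k Y (T ((S.tw k X).symm x)) := rfl

theorem isAdjointable_twistMap (k : ℕ) {T : IPMap X Y} (hT : T.IsAdjointable) :
    (S.twistMap k T).IsAdjointable := by
  obtain ⟨T', hT'⟩ := hT
  exact ⟨fun y => S.tw k X (T' ((S.tw k Y).symm y)), fun x y =>
    congrArg (S.transfer ^ k) (hT' ((S.tw k X).symm x) ((S.tw k Y).symm y))⟩

/-- The identification `X ⊗ M_L = X_L` is natural. -/
theorem tensorTwist_tensorMap (T : IPMap X Y) (z : (S.tensor X).carrier) :
    S.tensorTwist Y (S.tensorMap T z) = S.twistMap 1 T (S.tensorTwist X z) := by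
  refine S.tensor_map_ext (f := (S.tensorTwist Y).comp (S.tensorMap T))
    (g := (S.twistMap 1 T).comp (S.tensorTwist X)) (fun x m => ?_) z
  rw [IPMap.comp_apply, IPMap.comp_apply, tensorMap_tmul, tensorTwist_tmul, tensorTwist_tmul,
    twistMap_apply, LinearEquiv.symm_apply_apply, T.map_act]

theorem tensorMap_comp {Z : HilbertModule.{u₃} C} (U : IPMap Y Z) (T : IPMap X Y)
    (z : (S.tensor X).carrier) :
    S.tensorMap (U.comp T) z = S.tensorMap U (S.tensorMap T z) := by
  refine S.tensor_map_ext (f := S.tensorMap (U.comp T))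
    (g := (S.tensorMap U).comp (S.tensorMap T)) (fun x m => ?_) z
  rw [IPMap.comp_apply, tensorMap_tmul, tensorMap_tmul, tensorMap_tmul, IPMap.comp_apply]

/-- The adjoint is found on `X_L` instead of being built as `T' ⊗ id`, which `tensorMap` does not
cover because `T'` need not preserve inner products. On `X_L` the old `T'` still works: apply `L` to
both sides of its defining identity. -/
theorem isAdjointable_tensorMap {T : IPMap X Y} (hT : T.IsAdjointable) :
    (S.tensorMap T).IsAdjointable := by
  obtain ⟨T', hT'⟩ := S.isAdjointable_twistMap 1 hT
  have h := S.surjective_tensorTwist X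
  refine ⟨fun y => (S.tensorTwist X).inverse h (T' (S.tensorTwist Y y)), fun x y => ?_⟩
  rw [← (S.tensorTwist Y).inner_apply, tensorTwist_tensorMap, hT',
    ← (S.tensorTwist X).inner_apply x, IPMap.apply_inverse]

end Tensor

/-! ### The dilation operator as a unitary `X → X ⊗ M_L`. -/

section Dilation

variable {X : HilbertModule.{v} C} (D : X.carrier ≃ₗ[ℂ] X.carrier)
  (hD : ∀ (f : C(C, ℂ)) (x : X.carrier), D (f • x) = S.endo f • D x)
  (hL : ∀ x y : X.carrier, S.transfer (inner C(C, ℂ) (D x) (D y)) = inner C(C, ℂ) x y)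

/-- A dilation operator `D` on `X`, regarded as a map `X → X_L`. -/
def dilationTwist : IPMap X (S.twist 1 X) where
  toLinearMap := (S.tw 1 X).toLinearMap ∘ₗ D.toLinearMap
  map_action a x := (S.tw 1 X).symm.injective (hD a x)
  inner_map := hL

/-- A dilation operator `D` on `X`, regarded as a map `X → X ⊗ M_L`. -/
def dilationTensor : IPMap X (S.tensor X) :=
  ((S.tensorTwist X).inverse (S.surjective_tensorTwist X)).comp (S.dilationTwist D hD hL)

theorem tensorTwist_dilationTensor (x : X.carrier) :
    S.tensorTwist X (S.dilationTensor D hD hL x) = S.tw 1 X (D x) :=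
  (S.tensorTwist X).apply_inverse (S.surjective_tensorTwist X) _

theorem surjective_dilationTensor : Function.Surjective (S.dilationTensor D hD hL) :=
  ((S.tensorTwist X).surjective_inverse (S.surjective_tensorTwist X)).comp ((S.tw 1 X).surjective.comp D.surjective)

end Dilation

/-! ### Sequences with `X k ⊗ M_L = X (k + 1)`: the limit and its embeddings. -/

section System

variable {X : ℕ → HilbertModule.{u} C} (T : ∀ k, IPMap (X k) (X (k + 1)))
  (E : ∀ k, IPMap (S.tensor (X k)) (X (k + 1)))

/-- By compatibility, `T (k + 1)` is `T k ⊗ id` conjugated by the unitaries `E k` and `E (k + 1)`,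
so adjoints pass from one stage to the next. -/
theorem isAdjointable_of_compatible (hE : ∀ k, Function.Surjective (E k))
    (hTE : ∀ k z, T (k + 1) (E k z) = E (k + 1) (S.tensorMap (T k) z))
    (hT : (T 0).IsAdjointable) (k : ℕ) : (T k).IsAdjointable := by
  induction k with
  | zero => exact hT
  | succ k ih =>
    obtain ⟨T', hT'⟩ := S.isAdjointable_tensorMap ih
    refine ⟨fun y => E k (T' ((E (k + 1)).inverse (hE _) y)), fun x y => ?_⟩
    obtain ⟨x, rfl⟩ := hE k x
    obtain ⟨y, rfl⟩ := hE (k + 1) y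
    rw [hTE, IPMap.inner_apply, IPMap.inner_apply, IPMap.inverse_apply, hT']

/-- If the sequence `X_k` satisfies `X_k ⊗ M_L = X_{k+1}`, compatibly with the maps `T_k`, then
`X_∞ = X_∞ ⊗ M_L`. -/
theorem exists_limit_tensor (hE : ∀ k, Function.Surjective (E k))
    (hTE : ∀ k z, T (k + 1) (E k z) = E (k + 1) (S.tensorMap (T k) z)) :
    ∃ R : IPMap (HilbertModule.limit T) (S.tensor (HilbertModule.limit T)),
      Function.Surjective R ∧ ∀ k z, R (HilbertModule.toLimit T (k + 1) (E k z)) =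
        S.tensorMap (HilbertModule.toLimit T k) z := by
  -- The required identity `R ∘ ι^{k+1} ∘ E k = ι^k ⊗ id` leaves no other choice for `R ∘ ι^{k+1}`.
  let h (k : ℕ) : IPMap (X (k + 1)) (S.tensor (HilbertModule.limit T)) :=
    (S.tensorMap (HilbertModule.toLimit T k)).comp ((E k).inverse (hE k))
  have hh (k : ℕ) (z) : h k (E k z) = S.tensorMap (HilbertModule.toLimit T k) z := by
    rw [IPMap.comp_apply, IPMap.inverse_apply]
  have hsucc (k : ℕ) (z) : h (k + 1) (T (k + 1) z) = h k z := by
    obtain ⟨z, rfl⟩ := hE k z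
    rw [hTE, hh, hh, ← tensorMap_comp]
    refine S.tensor_map_ext (fun x m => ?_) z
    rw [tensorMap_tmul, tensorMap_tmul, IPMap.comp_apply, HilbertModule.toLimit_succ]
  -- The maps `h k` start at `X (k + 1)`, so `X k` is first moved up one stage by `T k`; this also
  -- supplies the value on `X 0`.
  let R := HilbertModule.limitLift T (fun k => (h k).comp (T k)) fun k x => hsucc k (T k x)
  have hR (k : ℕ) (z) : R (HilbertModule.toLimit T (k + 1) (E k z)) =
      S.tensorMap (HilbertModule.toLimit T k) z := by
    refine (HilbertModule.limitLift_toLimit T _ _ _ _).trans ?_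
    rw [IPMap.comp_apply, hsucc, hh]
  refine ⟨R, fun z => ?_, hR⟩
  let RT := (S.tensorTwist _).comp R
  -- Surjectivity is tested in `(X_∞)_L`, whose underlying space is `X_∞`, so that density of the
  -- ranges of the `ι^k` applies directly.
  suffices hs : ∀ y, S.tw 1 _ y ∈ Set.range RT by
    obtain ⟨x, hx⟩ := hs ((S.tw 1 _).symm (S.tensorTwist _ z))
    rw [LinearEquiv.apply_symm_apply] at hx
    exact ⟨x, (S.tensorTwist _).injective hx⟩
  -- The identity `X_∞ → (X_∞)_L` is contractive because `L` is. Hence the closed range of `RT`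
  -- pulls back to a closed subset of `X_∞`.
  have hc : Continuous (S.tw 1 (HilbertModule.limit T)) := by
    refine ((S.tw 1 (HilbertModule.limit T)).toLinearMap.mkContinuous 1 fun x => ?_).continuous
    rw [one_mul, CStarModule.norm_eq_sqrt_norm_inner_self (A := C(C, ℂ)),
      CStarModule.norm_eq_sqrt_norm_inner_self (A := C(C, ℂ)) x]
    exact Real.sqrt_le_sqrt (S.norm_transferPow_le 1 _)
  intro y
  refine closure_minimal ?_ (RT.isClosed_range.preimage hc)
    (HilbertModule.dense_iUnion_range_toLimit T y)
  refine Set.iUnion_subset fun k => ?_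
  rintro _ ⟨x, rfl⟩
  obtain ⟨z, hz⟩ := S.surjective_tensorTwist (X k) (S.tw 1 _ x)
  refine ⟨HilbertModule.toLimit T (k + 1) (E k z), ?_⟩
  rw [IPMap.comp_apply, hR, tensorTwist_tensorMap, hz, twistMap_apply,
    LinearEquiv.symm_apply_apply]

/-- A dilation operator `D` on `Z` and a compatible embedding of `X_0` in `Z` determine an
embedding of `X_∞` in `Z` and a projective multi-resolution analysis. -/
theorem exists_limit_projectiveMRA (hE : ∀ k, Function.Surjective (E k))
    (hTE : ∀ k z, T (k + 1) (E k z) = E (k + 1) (S.tensorMap (T k) z))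
    (hT : (T 0).IsAdjointable)
    {R : IPMap (HilbertModule.limit T) (S.tensor (HilbertModule.limit T))}
    (hR : ∀ k z, R (HilbertModule.toLimit T (k + 1) (E k z)) =
      S.tensorMap (HilbertModule.toLimit T k) z)
    {Z : HilbertModule.{v} C} (D : Z.carrier ≃ₗ[ℂ] Z.carrier)
    (hD : ∀ (f : C(C, ℂ)) (x : Z.carrier), D (f • x) = S.endo f • D x)
    (hL : ∀ x y : Z.carrier, S.transfer (inner C(C, ℂ) (D x) (D y)) = inner C(C, ℂ) x y)
    (Q₀ : IPMap (X 0) Z)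
    (hQ₀ : ∀ x z, E 0 z = T 0 x → D (Q₀ x) = Q₀ ((S.tw 1 _).symm (S.tensorTwist _ z))) :
    ∃ Q : IPMap (HilbertModule.limit T) Z,
      (∀ x, Q (HilbertModule.toLimit T 0 x) = Q₀ x) ∧
      (∀ z, D (Q z) = Q ((S.tw 1 _).symm (S.tensorTwist _ (R z)))) ∧
      HilbertModule.IsProjectiveMRA D (LinearMap.range Q.toLinearMap)
        (fun k => LinearMap.range
          (Q.toLinearMap ∘ₗ (HilbertModule.toLimit T k).toLinearMap)) := by
  let D' := S.dilationTensor D hD hL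
  have hD' := S.surjective_dilationTensor D hD hL
  -- Forced by the desired relation `D' ∘ q (k + 1) ∘ E k = q k ⊗ id`.
  let q : ∀ k, IPMap (X k) Z := fun k => Nat.rec Q₀
    (fun k q => (D'.inverse hD').comp ((S.tensorMap q).comp ((E k).inverse (hE k)))) k
  have hq (k : ℕ) (z) : D' (q (k + 1) (E k z)) = S.tensorMap (q k) z := by
    change D' (D'.inverse hD' (S.tensorMap (q k) ((E k).inverse (hE k) (E k z)))) = _
    rw [IPMap.apply_inverse, IPMap.inverse_apply]
  have hDq (k : ℕ) (z) : D (q (k + 1) (E k z)) =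
      q k ((S.tw 1 _).symm (S.tensorTwist _ z)) := by
    apply (S.tw 1 Z).injective
    rw [← S.tensorTwist_dilationTensor D hD hL, hq, tensorTwist_tensorMap, twistMap_apply]
  -- The base case is the hypothesis `hQ₀`, that is `D Q₀ = Q₀ T` with `T 0` read through `E 0`. In
  -- the inductive step, applying `D'` turns the claim into `(q (k + 1) ∘ T k) ⊗ id = q k ⊗ id`.
  have hqT (k : ℕ) (x) : q (k + 1) (T k x) = q k x := by
    induction k with
    | zero =>
      obtain ⟨z, hz⟩ := hE 0 (T 0 x)
      apply D.injective
      rw [← hz, hDq]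
      exact (hQ₀ x z hz).symm
    | succ k ih =>
      obtain ⟨z, rfl⟩ := hE k x
      apply D'.injective
      rw [hTE]
      refine (hq _ _).trans (Eq.trans ?_ (hq _ _).symm)
      rw [← tensorMap_comp]
      refine S.tensor_map_ext (fun x m => ?_) z
      rw [tensorMap_tmul, tensorMap_tmul, IPMap.comp_apply, ih]
  let Q := HilbertModule.limitLift T q hqT
  have hQ (k : ℕ) (x) : Q (HilbertModule.toLimit T k x) = q k x :=
    HilbertModule.limitLift_toLimit T q hqT k x
  have hQq (k : ℕ) : LinearMap.range (Q.toLinearMap ∘ₗ (HilbertModule.toLimit T k).toLinearMap) =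
      LinearMap.range (q k).toLinearMap :=
    congrArg LinearMap.range (LinearMap.ext (hQ k))
  -- As `q k = q (k + 1) ∘ T k`, this is the complemented range of the adjointable `T k`, carried
  -- into `Z` by `q (k + 1)`.
  have hcomp (k : ℕ) : HilbertModule.IsComplementedIn (LinearMap.range (q k).toLinearMap)
      (LinearMap.range (q (k + 1)).toLinearMap) := by
    have h := (S.isAdjointable_of_compatible T E hE hTE hT k).isComplementedIn_range_comp
      (q (k + 1))
    rwa [show ((q (k + 1)).comp (T k)).toLinearMap = (q k).toLinearMap from
      LinearMap.ext (hqT k)] at h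
  have hle (k : ℕ) : LinearMap.range (q k).toLinearMap ≤ LinearMap.range Q.toLinearMap := by
    rw [← hQq]
    exact LinearMap.range_comp_le_range _ _
  have hdense : (LinearMap.range Q.toLinearMap : Set Z.carrier) ⊆
      closure (⋃ k, (LinearMap.range (q k).toLinearMap : Set Z.carrier)) := by
    simp_rw [← hQq]
    exact HilbertModule.range_subset_closure_iUnion T Q
  have hpre (k : ℕ) : (LinearMap.range (q (k + 1)).toLinearMap : Set Z.carrier) =
      D ⁻¹' (LinearMap.range (q k).toLinearMap : Set Z.carrier) := by
    ext x
    constructor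
    · rintro ⟨y, rfl⟩
      obtain ⟨z, rfl⟩ := hE k y
      exact ⟨_, (hDq k z).symm⟩
    -- The point `y`, viewed in `(X k)_L`, comes from a tensor `z`, and `q (k + 1) (E k z)` then has
    -- the same image under `D` as `x`.
    · rintro ⟨y, hy⟩
      obtain ⟨z, hz⟩ := S.surjective_tensorTwist (X k) (S.tw 1 _ y)
      refine ⟨E k z, D.injective ?_⟩
      refine (hDq k z).trans ?_
      rw [hz, LinearEquiv.symm_apply_apply]
      exact hy
  refine ⟨Q, hQ 0, fun z => ?_, ?_⟩
  -- In `Z ⊗ M_L` the claim reads `D' ∘ Q = (Q ⊗ id) ∘ R`; on `ι^{k+1} (E k x)` both sides equal `(q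
  -- k ⊗ id) x`.
  · apply (S.tw 1 Z).injective
    rw [← S.tensorTwist_dilationTensor D hD hL, ← twistMap_apply, ← tensorTwist_tensorMap]
    congr 1
    refine HilbertModule.limit_map_ext T (f := D'.comp Q) (g := (S.tensorMap Q).comp R)
      (fun k x => ?_) z
    obtain ⟨x, rfl⟩ := hE k x
    rw [IPMap.comp_apply, IPMap.comp_apply, hQ, hq, hR, ← tensorMap_comp]
    refine S.tensor_map_ext (fun x m => ?_) x
    rw [tensorMap_tmul, tensorMap_tmul, IPMap.comp_apply, hQ]
  · simp_rw [hQq]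
    refine ⟨HilbertModule.isComplementedIn_of_dense Q.range_isClosedSubmodule hcomp hle hdense,
      fun k => ?_, hcomp, hle, hdense⟩
    induction k with
    | zero => rfl
    | succ k ih => rw [hpre, ih, Function.iterate_succ, Set.preimage_comp]

end System

end ExelSystem

end

noncomputable section

/-- A surjective `U` is unitary, with adjoint `U⁻¹`, so `T' ∘ U⁻¹` is an adjoint of `U ∘ T`. -/
theorem IPMap.IsAdjointable.comp_of_surjective {C : Type w} [TopologicalSpace C] [CompactSpace C]
    {X : HilbertModule.{u₁} C} {Y : HilbertModule.{u₂} C} {Z : HilbertModule.{u₃} C}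
    {T : IPMap X Y} (hT : T.IsAdjointable) {U : IPMap Y Z} (hU : Function.Surjective U) :
    (U.comp T).IsAdjointable := by
  obtain ⟨T', hT'⟩ := hT
  refine ⟨fun z => T' (U.inverse hU z), fun x z => ?_⟩
  obtain ⟨y, rfl⟩ := hU z
  rw [comp_apply, U.inner_apply, hT']
  exact congrArg (fun y => inner C(C, ℂ) x (T' y)) (U.inverse_apply hU y).symm

namespace ExelSystem

variable {C : Type w} [TopologicalSpace C] [CompactSpace C] [T2Space C] (S : ExelSystem C)

/-! ### The sequence `Y_{L^k}`. -/

section Twist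

variable (Y : HilbertModule.{u} C)

/-- The identity map from `(Y_{L^k})_{L^j}` to `Y_{L^n}`, where `n = j + k`. -/
def twistTwist (j k : ℕ) {n : ℕ} (h : k + j = n) :
    IPMap (S.twist j (S.twist k Y)) (S.twist n Y) where
  toLinearMap := (S.tw n Y).toLinearMap ∘ₗ
    (S.tw k Y).symm.toLinearMap ∘ₗ (S.tw j (S.twist k Y)).symm.toLinearMap
  map_action a x := by
    -- The exponent `n` is kept free so that `(Y_L)_{L^k}` and `(Y_{L^k})_L` both map to
    -- `Y_{L^{k+1}}`.
    subst h
    apply (S.tw (k + j) Y).symm.injective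
    rw [tw_symm_smul, pow_add]
    rfl
  inner_map x y := by
    subst h
    -- Inner products compose as `L^j ∘ L^k`, whereas the action composes as `α^k ∘ α^j`; hence the
    -- exponents are swapped only here.
    rw [inner_tw, inner_tw S j, inner_tw S k, add_comm, pow_add]
    rfl

theorem surjective_twistTwist (j k : ℕ) {n : ℕ} (h : k + j = n) :
    Function.Surjective (S.twistTwist Y j k h) :=
  (S.tw n Y).surjective.comp ((S.tw k Y).symm.surjective.comp (S.tw j _).symm.surjective)

/-- The identity map from `Y_{L^0}` to `Y`. -/
def twistZero : IPMap (S.twist 0 Y) Y where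
  toLinearMap := (S.tw 0 Y).symm.toLinearMap
  map_action _ _ := rfl
  inner_map _ _ := rfl

variable {Y}

/-- A map `T : Y → Y_L`, regarded as a map `Y_{L^k} → Y_{L^{k+1}}`. -/
def twistStep (T : IPMap Y (S.twist 1 Y)) (k : ℕ) : IPMap (S.twist k Y) (S.twist (k + 1) Y) :=
  (S.twistTwist Y k 1 (add_comm 1 k)).comp (S.twistMap k T)

theorem twistStep_tw (T : IPMap Y (S.twist 1 Y)) (k : ℕ) (y : Y.carrier) :
    S.twistStep T k (S.tw k Y y) = S.tw (k + 1) Y ((S.tw 1 Y).symm (T y)) := rfl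

theorem isAdjointable_twistStep {T : IPMap Y (S.twist 1 Y)} (hT : T.IsAdjointable) (k : ℕ) :
    (S.twistStep T k).IsAdjointable :=
  (S.isAdjointable_twistMap k hT).comp_of_surjective (S.surjective_twistTwist Y k 1 _)

variable (Y) in
/-- The identification `Y_{L^k} ⊗ M_L = Y_{L^{k+1}}`. -/
def tensorTwistSucc (k : ℕ) : IPMap (S.tensor (S.twist k Y)) (S.twist (k + 1) Y) :=
  (S.twistTwist Y 1 k rfl).comp (S.tensorTwist (S.twist k Y))

theorem surjective_tensorTwistSucc (k : ℕ) : Function.Surjective (S.tensorTwistSucc Y k) :=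
  (S.surjective_twistTwist Y 1 k rfl).comp (S.surjective_tensorTwist _)

/-- All the `Y_{L^k}` share one underlying space, on which every step is the same map `T`. Once
naturality has removed the tensor product, both sides coincide by definition. -/
theorem twistStep_tensorTwistSucc (T : IPMap Y (S.twist 1 Y)) (k : ℕ)
    (z : (S.tensor (S.twist k Y)).carrier) :
    S.twistStep T (k + 1) (S.tensorTwistSucc Y k z) =
      S.tensorTwistSucc Y (k + 1) (S.tensorMap (S.twistStep T k) z) := by
  rw [tensorTwistSucc, tensorTwistSucc, IPMap.comp_apply, IPMap.comp_apply, tensorTwist_tensorMap]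
  rfl

end Twist

/-! ### The sequence `M_L^{⊗ k}` of a filter. -/

section Filter

variable {m : S.ML.carrier} (hm : S.IsFilter m)

/-- The identification `M_L^{⊗ k} ⊗ M_L = M_L^{⊗ (k+1)}`. -/
def tensorPowSucc : (k : ℕ) → IPMap (S.tensor (S.tensorPow k)) (S.tensorPow (k + 1))
  | 0 => S.tensorTwist (HilbertModule.self C)
  | k + 1 => IPMap.id (S.tensorPow (k + 2))

theorem tensorPowSucc_zero_tmul (a : C(C, ℂ)) (n : S.ML.carrier) :
    S.tensorPowSucc 0 (S.tmul _ (S.scalar a) n) = S.leftMul a n :=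
  (S.tensorTwist_tmul (HilbertModule.self C) a n).trans
    (congrArg S.ofFun (mul_comm (S.ofFun.symm n) a))

theorem surjective_tensorPowSucc (k : ℕ) : Function.Surjective (S.tensorPowSucc k) := by
  cases k with
  | zero => exact S.surjective_tensorTwist (HilbertModule.self C)
  | succ k => exact Function.surjective_id

/-- The tensor product is balanced: `x · a ⊗ n = x ⊗ a · n`. -/
theorem tmul_action (X : HilbertModule.{u} C) (a : C(C, ℂ)) (x : X.carrier) (n : S.ML.carrier) :
    S.tmul X (a • x) n = S.tmul X x (S.leftMul a n) := by
  apply (S.tensorTwist X).injective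
  rw [tensorTwist_tmul, tensorTwist_tmul, ← X.mul_action, leftMul, LinearEquiv.symm_apply_apply,
    mul_comm]

/-- Only `k = 0` has content: `T_1 (a · n) = m ⊗ a · n = m · a ⊗ n = T_0 a ⊗ n`, by balancedness.
Afterwards `T_{k+1}` is `T_k ⊗ id` by definition. -/
theorem filterMap_tensorPowSucc (k : ℕ) (z : (S.tensor (S.tensorPow k)).carrier) :
    S.filterMap hm (k + 1) (S.tensorPowSucc k z) =
      S.tensorPowSucc (k + 1) (S.tensorMap (S.filterMap hm k) z) := by
  cases k with
  | zero =>
    refine S.tensor_map_ext (f := (S.filterMap hm 1).comp (S.tensorPowSucc 0))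
      (g := S.tensorMap (S.filterMap hm 0)) (fun a n => ?_) z
    refine (congrArg (S.filterMap hm 1) (S.tensorPowSucc_zero_tmul a n)).trans ?_
    exact (S.tmul_action S.ML a m n).symm.trans (S.tensorMap_tmul (S.filterMap hm 0) a n).symm
  | succ k => rfl

/-- The adjoint of `a ↦ m · a` is `n ↦ ⟨m, n⟩`. The later `T_k` are covered by
`isAdjointable_of_compatible`. -/
theorem isAdjointable_filterMap_zero : (S.filterMap hm 0).IsAdjointable := by
  refine ⟨fun n => S.scalar (inner C(C, ℂ) m n), fun a n => ?_⟩
  exact CStarModule.inner_op_smul_left (A := C(C, ℂ)) (E := S.ML.carrier)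

/-- The map `C(C) → X`, `a ↦ φ · a`, for `φ` with `⟨φ, φ⟩ = 1`. -/
def orbitMap {X : HilbertModule.{v} C} {φ : X.carrier} (hφ : inner C(C, ℂ) φ φ = (1 : C(C, ℂ))) :
    IPMap (S.tensorPow 0) X where
  toFun a := (show C(C, ℂ) from a) • φ
  map_add' a b := X.add_action a b φ
  map_smul' t a := X.smul_action t a φ
  map_action a b := X.mul_action a b φ
  inner_map a b := by
    rw [CStarModule.inner_op_smul_right, CStarModule.inner_op_smul_left, hφ, one_mul]
    rfl

theorem orbitMap_apply {X : HilbertModule.{v} C} {φ : X.carrier}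
    (hφ : inner C(C, ℂ) φ φ = (1 : C(C, ℂ))) (a : C(C, ℂ)) :
    S.orbitMap hφ (S.scalar a) = a • φ := rfl

end Filter

end ExelSystem

end

/-! ### The two cases assembled. -/

theorem mainTheorem5 {C : Type w} [TopologicalSpace C] [CompactSpace C] [T2Space C]
    (S : ExelSystem C) :
    -- general initial module `Y`
    (∀ (Y : HilbertModule.{u} C) (T : IPMap Y (S.twist 1 Y)), T.IsAdjointable →
      ∃ Tk : ∀ k, IPMap (S.twist k Y) (S.twist (k + 1) Y),
        (∀ k y, Tk k (S.tw k Y y) = S.tw (k + 1) Y ((S.tw 1 Y).symm (T y))) ∧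
        (∀ k, (Tk k).IsAdjointable) ∧
        ∃ R : IPMap (HilbertModule.limit Tk) (S.tensor (HilbertModule.limit Tk)),
          Function.Surjective R ∧
          (∀ k (z : (S.tensor (S.twist k Y)).carrier),
            R (HilbertModule.toLimit Tk (k + 1) (S.twSucc k Y (S.tensorTwist (S.twist k Y) z))) =
              S.tensorMap (HilbertModule.toLimit Tk k) z) ∧
          ∀ (X : HilbertModule.{v} C) (D : X.carrier ≃ₗ[ℂ] X.carrier) (Q₀ : IPMap Y X),
            (∀ (f : C(C, ℂ)) (x : X.carrier), D (f • x) = S.endo f • D x) →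
            (∀ x y : X.carrier, S.transfer (inner C(C, ℂ) (D x) (D y)) = inner C(C, ℂ) x y) →
            (∀ y, D (Q₀ y) = Q₀ ((S.tw 1 Y).symm (T y))) →
            ∃ Q : IPMap (HilbertModule.limit Tk) X,
              (∀ y, Q (HilbertModule.toLimit Tk 0 (S.tw 0 Y y)) = Q₀ y) ∧
              (∀ z, D (Q z) = Q ((S.tw 1 _).symm (S.tensorTwist _ (R z)))) ∧
              HilbertModule.IsProjectiveMRA D (LinearMap.range Q.toLinearMap)
                (fun k => LinearMap.range
                  (Q.toLinearMap ∘ₗ (HilbertModule.toLimit Tk k).toLinearMap))) ∧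
    -- initial module `C(C)` and a filter `m`
    (∀ (m : S.ML.carrier) (hm : S.IsFilter m),
      ∃ R : IPMap (HilbertModule.limit (S.filterMap hm))
          (S.tensor (HilbertModule.limit (S.filterMap hm))),
        Function.Surjective R ∧
        (∀ (a : C(C, ℂ)) (n : S.ML.carrier),
          R (HilbertModule.toLimit (S.filterMap hm) 1 (S.leftMul a n)) =
            S.tmul _ (HilbertModule.toLimit (S.filterMap hm) 0 (S.scalar a)) n) ∧
        (∀ k (z : (S.tensorPow (k + 2)).carrier),
          R (HilbertModule.toLimit (S.filterMap hm) (k + 2) z) =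
            S.tensorMap (HilbertModule.toLimit (S.filterMap hm) (k + 1)) z) ∧
        ∀ (X : HilbertModule.{v} C) (D : X.carrier ≃ₗ[ℂ] X.carrier) (φ : X.carrier),
          inner C(C, ℂ) φ φ = (1 : C(C, ℂ)) →
          (∀ (f : C(C, ℂ)) (x : X.carrier), D (f • x) = S.endo f • D x) →
          (∀ x y : X.carrier, S.transfer (inner C(C, ℂ) (D x) (D y)) = inner C(C, ℂ) x y) →
          D φ = S.ofFun.symm m • φ →
          (∃ D' : IPMap X (S.tensor X), (∀ x, S.tensorTwist X (D' x) = S.tw 1 X (D x)) ∧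
            S.IsScalingFunction m X D' φ) ∧
          ∃ Q : IPMap (HilbertModule.limit (S.filterMap hm)) X,
            Q (HilbertModule.toLimit (S.filterMap hm) 0 (S.scalar 1)) = φ ∧
            (∀ z, D (Q z) = Q ((S.tw 1 _).symm (S.tensorTwist _ (R z)))) ∧
            HilbertModule.IsProjectiveMRA D (LinearMap.range Q.toLinearMap)
              (fun k => LinearMap.range
                (Q.toLinearMap ∘ₗ (HilbertModule.toLimit (S.filterMap hm) k).toLinearMap))) := by
  refine ⟨fun Y T hT => ?_, fun m hm => ?_⟩
  · obtain ⟨R, hRs, hR⟩ := S.exists_limit_tensor (S.twistStep T) (S.tensorTwistSucc Y)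
      S.surjective_tensorTwistSucc (S.twistStep_tensorTwistSucc T)
    refine ⟨S.twistStep T, S.twistStep_tw T, S.isAdjointable_twistStep hT, R, hRs, hR, ?_⟩
    intro X D Q₀ hD hL hQ₀
    obtain ⟨Q, hQ, hDQ, hmra⟩ := S.exists_limit_projectiveMRA (S.twistStep T) (S.tensorTwistSucc Y)
      S.surjective_tensorTwistSucc (S.twistStep_tensorTwistSucc T)
      (S.isAdjointable_twistStep hT 0) hR D hD hL (Q₀.comp (S.twistZero Y)) fun x z hz =>
        (hQ₀ ((S.tw 0 Y).symm x)).trans (congrArg (fun y => Q₀ ((S.tw 1 Y).symm y)) hz.symm)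
    exact ⟨Q, fun y => hQ _, hDQ, hmra⟩
  · obtain ⟨R, hRs, hR⟩ := S.exists_limit_tensor (S.filterMap hm) S.tensorPowSucc
      S.surjective_tensorPowSucc (S.filterMap_tensorPowSucc hm)
    refine ⟨R, hRs, fun a n => ?_, fun k z => hR (k + 1) z, ?_⟩
    · rw [← S.tensorMap_tmul, ← hR, S.tensorPowSucc_zero_tmul]
    intro X D φ hφ hD hL hDφ
    refine ⟨⟨S.dilationTensor D hD hL, S.tensorTwist_dilationTensor D hD hL,
      S.surjective_dilationTensor D hD hL, hφ, ?_⟩, ?_⟩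
    · apply (S.tensorTwist X).injective
      rw [S.tensorTwist_dilationTensor, S.tensorTwist_tmul, hDφ]
    obtain ⟨Q, hQ, hDQ, hmra⟩ := S.exists_limit_projectiveMRA (S.filterMap hm) S.tensorPowSucc
      S.surjective_tensorPowSucc (S.filterMap_tensorPowSucc hm)
      (S.isAdjointable_filterMap_zero hm) hR D hD hL (S.orbitMap hφ) fun (a : C(C, ℂ)) z hz => by
        -- As a function, `T_0 a = m · a` is `α(a) m`. The compatibility of `D` with `Q₀` thus
        -- becomes `D(φ · a) = (φ · m) · α(a) = φ · (α(a) m)`.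
        have hz' : (S.tw 1 (HilbertModule.self C)).symm
            (S.tensorTwist (HilbertModule.self C) z) =
              (S.endo a * S.ofFun.symm m : C(C, ℂ)) :=
          congrArg S.ofFun.symm hz
        refine (hD a φ).trans ?_
        rw [hDφ, ← X.mul_action]
        exact congrArg (fun b : C(C, ℂ) => b • φ) hz'.symm
    refine ⟨Q, (hQ _).trans ?_, hDQ, hmra⟩
    rw [S.orbitMap_apply]
    exact X.ext_inner fun z => by simp
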